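/- **Theorem C.** Let $\lambda$ be a regular uncountable cardinal such that $\diamondsuit(\lambda)$ and Gray's principle $\framebox[3.0mm][l]{$\diamondsuit$}\hspace{0.5mm}{}_\lambda$ both hold, and let $\kappa:=\lambda^+$. Then there exists an injective sequence $\langle T^\eta\mid \eta<2^{\kappa}\rangle$ of streamlined, normal, binary, splitting, full $\kappa$-Souslin trees such that, for every nonzero cardinal $\chi<\lambda$ and every injective sequence $\langle\eta_j\mid j<\chi\rangle$ of elements of $2^{\kappa}$, the product tree $\bigotimes_{j<\chi}T^{\eta_j}$ is $\kappa$-Souslin. Here: - For a set $C$ of ordinals, $\mathrm{acc}(C):=\{\beta\in C\mid \sup(C\cap\beta)=\beta>0\}$. - $\diamondsuit(\lambda)$ asserts that there is a sequence $\langle f_\beta\mid\beta<\lambda\rangle$ such that for every function $f:\lambda\to\lambda$ the set $\{\beta<\lambda\mid f\restriction\beta=f_\beta\}$ is stationary in $\lambda$. - $\framebox[3.0mm][l]{$\diamondsuit$}\hspace{0.5mm}{}_\lambda$ asserts that there is a sequence $\langle (C_\alpha,X_\alpha)\mid\alpha<\lambda^+\text{ limit}\rangle$ such that: each $C_\alpha$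 is a club in $\alpha$ of order type at most $\lambda$, and $X_\alpha\subseteq\alpha$; if $\beta\in\mathrm{acc}(C_\alpha)$, then $C_\beta=C_\alpha\cap\beta$ and $X_\beta=X_\alpha\cap\beta$; and for every $Y\subseteq\lambda^+$ and every club $E\subseteq\lambda^+$ there is a limit $\alpha<\lambda^+$ with $\mathrm{otp}(C_\alpha)=\lambda$, $\mathrm{acc}(C_\alpha)\subseteq E$ and $X_\alpha=Y\cap\alpha$. - A partially ordered set $(T,<_T)$ is a $\kappa$-tree if for every $x\in T$ the set $x_\downarrow:=\{y\in T\mid y<_Tx\}$ is well-ordered (its order type is the height of $x$), for every $\alpha<\kappa$ the level $T_\alpha$ of all nodes of height $\alpha$ is nonempty and of size less than $\kappa$, and $T_\kappa=\emptyset$. An $\alpha$-branch is a chain $B\subseteq T$ whose set of heights is $\alpha$; it is vanishing if it has no upper bound in $T$. - A $\kappa$-tree is full if for every limit $\alpha<\kappa$ it has at most one vanishing $\alpha$-branch; normal if for all $\alpha<\beta<\kappa$ every $x\in T_\alpha$ lies below some $y\in T_\beta$; splitting if every node has at least two immediate successors; $\kappa$-Souslin if it has no $\kappa$-branches and no antichains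 of size $\kappa$. - A streamlined binary $\kappa$-tree is a set $T\subseteq{}^{<\kappa}2$, ordered by inclusion, that is closed under restrictions to ordinals and such that $T\cap{}^\alpha2$ is nonempty and of size less than $\kappa$ for every $\alpha<\kappa$. - The product of a nonempty family $\langle \mathbf T^j\mid j\in J\rangle$ of $\kappa$-trees is the set $\bigcup_{\alpha<\kappa}\prod_{j\in J}(\mathbf T^j)_\alpha$, ordered by $\vec s<\vec t$ iff $\vec s(j)<_{\mathbf T^j}\vec t(j)$ for every $j\in J$. -/

import Mathlib

universe u

open Cardinal

/-! ### Abstract trees -/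

section AbstractTrees

variable {T : Type u} [PartialOrder T]

open Classical in
/-- The height of `x`: the order type of the set of predecessors `{y | y < x}`
(with the default value `0` if that set is not well-ordered, which never happens in a tree). -/
noncomputable def treeHeight (x : T) : Ordinal.{u} :=
  if h : IsWellOrder (Set.Iio x) (· < ·) then
    @Ordinal.type (Set.Iio x) (· < ·) h
  else 0

variable (T) in
/-- The `α`-th level of the tree. -/
def treeLevel (α : Ordinal.{u}) : Set T := {x | treeHeight x = α}

variable (T) in
/-- `T` is a `κ`-tree: predecessor sets are well-ordered, every level `α < κ` is nonempty and of
size less than `κ`, and level `κ` is empty. -/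
structure IsKappaTree (κ : Cardinal.{u}) : Prop where
  wellOrdered : ∀ x : T, IsWellOrder (Set.Iio x) (· < ·)
  level_nonempty : ∀ α < κ.ord, (treeLevel T α).Nonempty
  level_small : ∀ α < κ.ord, #(treeLevel T α) < κ
  level_top_empty : treeLevel T κ.ord = ∅

/-- `B` is an `α`-branch: a chain whose set of heights is exactly `α`. -/
def IsTreeBranch (α : Ordinal.{u}) (B : Set T) : Prop :=
  IsChain (· ≤ ·) B ∧ treeHeight '' B = Set.Iio α

/-- `B` is vanishing: it has no upper bound in the tree. -/
def IsVanishing (B : Set T) : Prop := ¬ ∃ y : T, ∀ x ∈ B, x ≤ y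

variable (T) in
/-- Full: at every limit level below `κ` at most one branch vanishes. -/
def IsFullTree (κ : Cardinal.{u}) : Prop :=
  ∀ α < κ.ord, Order.IsSuccLimit α → ∀ B B' : Set T,
    IsTreeBranch α B → IsVanishing B → IsTreeBranch α B' → IsVanishing B' → B = B'

variable (T) in
/-- Normal: every node has extensions at all higher levels below `κ`. -/
def IsNormalTree (κ : Cardinal.{u}) : Prop :=
  ∀ α β : Ordinal.{u}, α < β → β < κ.ord →
    ∀ x ∈ treeLevel T α, ∃ y ∈ treeLevel T β, x < y

variable (T) in
/-- Splitting: every node has at least two immediate successors. -/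
def IsSplittingTree : Prop := ∀ x : T, ∃ y z : T, y ≠ z ∧ x ⋖ y ∧ x ⋖ z

variable (T) in
/-- `κ`-Souslin: a `κ`-tree with no `κ`-branches and no antichains (sets of pairwise incomparable
nodes) of size `κ`. -/
structure IsSouslinTree (κ : Cardinal.{u}) : Prop where
  isKappaTree : IsKappaTree T κ
  no_branch : ¬ ∃ B : Set T, IsTreeBranch κ.ord B
  no_antichain : ¬ ∃ A : Set T, IsAntichain (· ≤ ·) A ∧ #A = κ

end AbstractTrees

/-! ### Products of trees -/

/-- The underlying set of the product of a family of trees: the union, over `α < κ`, of the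
products of the `α`-th levels. -/
def TreeProduct (κ : Cardinal.{u}) {J : Type u} (T : J → Type u) [∀ j, PartialOrder (T j)] :
    Type u :=
  {s : ∀ j, T j // ∃ α < κ.ord, ∀ j, s j ∈ treeLevel (T j) α}

/-- The product is ordered by `s < t` iff `s j < t j` for every `j`; see `TreeProduct.lt_iff`. -/
instance TreeProduct.instPartialOrder (κ : Cardinal.{u}) {J : Type u} (T : J → Type u)
    [∀ j, PartialOrder (T j)] : PartialOrder (TreeProduct κ T) where
  le s t := s = t ∨ ∀ j, s.1 j < t.1 j
  le_refl s := Or.inl rfl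
  le_trans r s t := by
    rintro (rfl | h₁) (rfl | h₂)
    · exact Or.inl rfl
    · exact Or.inr h₂
    · exact Or.inr h₁
    · exact Or.inr fun j => (h₁ j).trans (h₂ j)
  le_antisymm s t := by
    rintro (rfl | h₁) (h | h₂)
    · rfl
    · rfl
    · exact h.symm
    · exact Subtype.ext (funext fun j => absurd (h₂ j) (h₁ j).asymm)

theorem TreeProduct.lt_iff (κ : Cardinal.{u}) {J : Type u} [Nonempty J] (T : J → Type u)
    [∀ j, PartialOrder (T j)] (s t : TreeProduct κ T) : s < t ↔ ∀ j, s.1 j < t.1 j := by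
  constructor
  · intro h
    rcases h.le with rfl | h'
    · exact absurd h (lt_irrefl _)
    · exact h'
  · intro h
    refine lt_of_le_of_ne (Or.inr h) ?_
    rintro rfl
    exact lt_irrefl _ (h (Classical.arbitrary J))

/-! ### Streamlined binary trees -/

/-- An element of `^{<κ}2`: a function to `2` whose domain is an ordinal `len < κ`.
Ordinals below `κ` are represented by the elements of the well-order `κ.ord.ToType`. -/
structure BinSeq (κ : Cardinal.{u}) : Type u where
  /-- the domain of the sequence -/
  len : κ.ord.ToType
  /-- the values of the sequence -/
  val : Set.Iio len → Bool

/-- Sequences are ordered by inclusion, i.e. `t` extends `s`. -/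
instance BinSeq.instPartialOrder (κ : Cardinal.{u}) : PartialOrder (BinSeq κ) where
  le s t := ∃ h : s.len ≤ t.len, ∀ a (ha : a < s.len),
    s.val ⟨a, ha⟩ = t.val ⟨a, lt_of_lt_of_le ha h⟩
  le_refl s := ⟨le_rfl, fun _ _ => rfl⟩
  le_trans r s t := by
    rintro ⟨h₁, e₁⟩ ⟨h₂, e₂⟩
    exact ⟨h₁.trans h₂, fun a ha => (e₁ a ha).trans (e₂ a _)⟩
  le_antisymm s t := by
    rintro ⟨h₁, e₁⟩ ⟨h₂, -⟩
    obtain ⟨l, v⟩ := s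
    obtain ⟨l', v'⟩ := t
    obtain rfl : l = l' := le_antisymm h₁ h₂
    obtain rfl : v = v' := funext fun a => e₁ a.1 a.2
    rfl

/-- A streamlined binary `κ`-tree: a subset of `^{<κ}2` that is closed under restrictions to
ordinals and whose set of elements with domain `α` is, for every `α < κ`, nonempty and of size less
than `κ`. It is regarded as the poset of its elements ordered by inclusion. -/
structure IsStreamlinedBinaryTree (κ : Cardinal.{u}) (T : Set (BinSeq κ)) : Prop where
  downward_closed : ∀ t ∈ T, ∀ s : BinSeq κ, s ≤ t → s ∈ T
  level_nonempty : ∀ a : κ.ord.ToType, {t ∈ T | t.len = a}.Nonempty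
  level_small : ∀ a : κ.ord.ToType, #{t ∈ T | t.len = a} < κ

/-! ### Diamond principles -/

/-- `acc(C)`: the nonzero elements `β` of `C` such that `sup (C ∩ β) = β`. -/
def accPoints {K : Type u} [LinearOrder K] (C : Set K) : Set K :=
  {β ∈ C | ¬ IsMin β ∧ IsLUB (C ∩ Set.Iio β) β}

/-- Jensen's diamond principle `◊(μ)`: there is a sequence `⟨f β | β < μ⟩` such that for every
function `f : μ → μ` the set of all `β < μ` with `f ↾ β = f β` is stationary in `μ`. -/
def DiamondPrinciple (μ : Cardinal.{u}) : Prop :=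
  ∃ F : (β : μ.ord.ToType) → Set.Iio β → μ.ord.ToType,
    ∀ f : μ.ord.ToType → μ.ord.ToType,
      IsStationary {β : μ.ord.ToType | ∀ γ : Set.Iio β, f γ = F β γ}

/-- Gray's principle (square with a built-in diamond) at `μ`: there is a sequence
`⟨(C α, X α) | α < μ⁺ limit⟩` such that
* `C α` is a club in `α` of order type at most `μ`, and `X α ⊆ α`;
* if `β ∈ acc (C α)`, then `C β = C α ∩ β` and `X β = X α ∩ β`;
* for every `Y ⊆ μ⁺` and every club `E` in `μ⁺`, there is a limit `α < μ⁺` such that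
  `otp (C α) = μ`, `acc (C α) ⊆ E` and `X α = Y ∩ α`. -/
def DiamondSquarePrinciple (μ : Cardinal.{u}) : Prop :=
  ∃ C X : (Order.succ μ).ord.ToType → Set (Order.succ μ).ord.ToType,
    (∀ α, Order.IsSuccLimit α →
      C α ⊆ Set.Iio α ∧
      IsClub {γ : Set.Iio α | γ.1 ∈ C α} ∧
      Ordinal.type (α := C α) (· < ·) ≤ μ.ord ∧
      X α ⊆ Set.Iio α ∧
      ∀ β ∈ accPoints (C α), C β = C α ∩ Set.Iio β ∧ X β = X α ∩ Set.Iio β) ∧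
    ∀ Y E : Set (Order.succ μ).ord.ToType, IsClub E →
      ∃ α, Order.IsSuccLimit α ∧
        Ordinal.type (α := C α) (· < ·) = μ.ord ∧
        accPoints (C α) ⊆ E ∧
        X α = Y ∩ Set.Iio α

/-! ### Padded binary sequences: restriction, gluing, enumeration of levels. -/

section Construction

open Set

variable {K L : Type u} [LinearOrder K]

/-! Write κ = λ⁺. For each η : κ → 2 a tree is built by recursion on levels, level c depending only
on η below c. A limit level receives every branch through the earlier levels, except possibly one,
so the tree is full. The ladder at c is acc(C_c); by coherence, nodes at a ladder point have
canonical extensions along the later ladder points. A branch is dropped at c only if it follows the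
diamond guess along a cofinal ladder and deviates from canonical extensions arbitrarily high up in
it. Canonical branches are therefore never dropped, which gives normality
(`Valid.normalAt_and_canAt`).

If otp(C_a) = λ, a branch below a that never becomes canonical would be guessed by ◊(λ) at a ladder
point c closed under its deviations, and would have been dropped there. Hence every branch below a
is canonical from some ladder point on (`Long.exists_canonical`). Together with λ^{<λ} = λ, which
handles shorter ladders, this bounds all levels by λ (`Valid.mk_Lev_le`).

The freedom left is the passage from a ladder point m to the next one, c. There the square guess is
read as a family of indices η_j together with a set of vectors of nodes, and the diamond guess at m
as a vector of nodes further down. If some vector at level c canonically extends the latter up to m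
and passes through the set, one is fixed, and the tree of η_j follows its j-th coordinate. Given a
dense set of vectors from fewer than λ distinct trees, Gray's principle yields a with otp(C_a) = λ
where everything is guessed correctly. A vector at level a is canonical from a common b₀ on, its
trace at b₀ is guessed at some m above b₀, and so it meets the dense set below the next ladder point
(`Valid.exists_hit`). This makes the trees and their products Souslin (`IsLevelFun.isSouslinTree`).
Applied to two trees and the pairs of distinct nodes, it also separates trees with different
indices. -/

/-- The restriction of `s` to the elements below `a`, padded with `false`. -/
def res (s : K → Bool) (a : K) : K → Bool := fun x => if x < a then s x else false

theorem res_apply_of_lt {s : K → Bool} {a x : K} (h : x < a) : res s a x = s x := if_pos h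

theorem res_res (s : K → Bool) (a b : K) : res (res s a) b = res s (min a b) := by
  funext x
  by_cases h₁ : x < a <;> by_cases h₂ : x < b <;> simp [res, h₁, h₂]

theorem res_res_of_le (s : K → Bool) {a b : K} (h : b ≤ a) : res (res s a) b = res s b := by
  rw [res_res, min_eq_right h]

@[simp] theorem res_res_self (s : K → Bool) (a : K) : res (res s a) a = res s a :=
  res_res_of_le s le_rfl

theorem res_of_le {s : K → Bool} {a b : K} (hs : res s a = s) (h : a ≤ b) : res s b = s := by
  rw [← hs, res_res, min_eq_left h]

theorem res_eq_iff {s t : K → Bool} {a : K} : res s a = res t a ↔ ∀ x < a, s x = t x := by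
  constructor
  · intro h x hx
    have := congrFun h x
    rwa [res_apply_of_lt hx, res_apply_of_lt hx] at this
  · intro h
    funext x
    by_cases hx : x < a
    · rw [res_apply_of_lt hx, res_apply_of_lt hx, h x hx]
    · simp [res, hx]

theorem res_eq_of_le {s t : K → Bool} {a b : K} (h : res s a = res t a) (hb : b ≤ a) :
    res s b = res t b := by
  rw [← res_res_of_le s hb, h, res_res_of_le t hb]

/-- Coherent sequences can be glued along a cofinal family of lengths. -/
theorem exists_glue {ι : Type*} {c : K} (a : ι → K) (t : ι → K → Bool) (ha : ∀ i, a i ≤ c)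
    (ht : ∀ i j, a i ≤ a j → res (t j) (a i) = t i) :
    ∃ s, res s c = s ∧ ∀ i, res s (a i) = t i := by
  classical
  refine ⟨fun x => if h : ∃ i, x < a i then t h.choose x else false, ?_, ?_⟩
  · funext x
    by_cases hx : x < c
    · rw [res_apply_of_lt hx]
    · have : ¬ ∃ i, x < a i := fun ⟨i, hi⟩ => hx (hi.trans_le (ha i))
      simp [res, hx, this]
  · intro i
    rw [← ht i i le_rfl, res_eq_iff]
    intro x hx
    have h : ∃ i, x < a i := ⟨i, hx⟩
    rw [dif_pos h]
    have hj := h.choose_spec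
    set j := h.choose
    rcases le_total (a i) (a j) with hij | hij
    · rw [← ht i j hij, res_apply_of_lt hx]
    · rw [← ht j i hij, res_apply_of_lt hj]

/-- Restrictions to a cofinal set of lengths determine a sequence. -/
theorem eq_of_res_eq {s t : K → Bool} {c : K} (hs : res s c = s) (ht : res t c = t)
    (h : ∀ x < c, ∃ b, x < b ∧ res s b = res t b) : s = t := by
  rw [← hs, ← ht, res_eq_iff]
  intro x hx
  obtain ⟨b, hb, e⟩ := h x hx
  exact res_eq_iff.1 e x hb

open Classical in
/-- An enumeration of `S` in type `L`, if there is any. -/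
noncomputable def enumOf (L : Type u) (S : Set (K → Bool)) : L → K → Bool :=
  if h : ∃ f : L → K → Bool, range f = S then h.choose else fun _ _ => false

omit [LinearOrder K] in
theorem range_enumOf {S : Set (K → Bool)} (hne : S.Nonempty) (hS : #S ≤ #L) :
    range (enumOf L S) = S := by
  have h : ∃ f : L → K → Bool, range f = S := by
    obtain ⟨e⟩ := hS
    have := hne.to_subtype
    refine ⟨fun l => (Function.invFun e l : S), ?_⟩
    ext s
    constructor
    · rintro ⟨l, rfl⟩
      exact Subtype.coe_prop _
    · intro hs
      exact ⟨e ⟨s, hs⟩, congrArg Subtype.val (Function.leftInverse_invFun e.injective ⟨s, hs⟩)⟩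
  rw [enumOf, dif_pos h]
  exact h.choose_spec

/-! ### The guessing data and the recursion for levels and canonical extensions. -/

variable (K L) in
/-- The data that drive the construction of the trees: a coherent ladder system `D`, indices `idx`
of the points of the ladders, guesses `Φ` for a family of sequences together with a set of vectors
of nodes, guesses `F` for a branch, and guesses `v` for a vector of nodes. The vectors of nodes
are coded by partial functions from `L` to `L`, which `w` enumerates. -/
structure Oracle where
  D : K → Set K
  idx : K → L
  Φ : K → K → Set (L ⊕ L)
  F : L → L → L
  w : L → L → Option L
  v : L → L × (L → Option L)

variable (K) in
/-- For every `η`, the level with index `η` and, for a ladder point `b` and a node `x` of height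
`b`, the canonical extension of `x` to the level. -/
structure LevelData where
  Lev : (K → Bool) → Set (K → Bool)
  can : K → (K → Bool) → (K → Bool) → K → Bool

namespace Oracle

variable (O : Oracle K L)

/-- The ladder at `c` is cofinal in `c`. -/
def Cof (c : K) : Prop := (O.D c).Nonempty ∧ ∀ x < c, ∃ b ∈ O.D c, x < b

open Classical in
/-- The `j`-th sequence guessed at `c`. -/
noncomputable def guessSeq (c : K) (j : L) : K → Bool := fun d => d < c ∧ Sum.inl j ∈ O.Φ c d

theorem res_guessSeq (c : K) (j : L) : res (O.guessSeq c j) c = O.guessSeq c j := by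
  funext x
  by_cases h : x < c <;> simp [res, guessSeq, h]

section Step

variable (c : K) (f : ∀ b < c, LevelData K)

/-- `s` is guessed at `c`, but it is not a canonical branch. -/
def StepDropped (η s : K → Bool) : Prop :=
  O.Cof c ∧
    (∀ b (h : b < c), b ∈ O.D c →
      res s b = enumOf L ((f b h).Lev η) (O.F (O.idx c) (O.idx b))) ∧
    -- This clause spares every branch that is canonical from some ladder point on; normality at `c`
    -- rests on it.
    ∀ b (_ : b < c), b ∈ O.D c → ∃ b', ∃ h' : b' < c, b' ∈ O.D c ∧ b < b' ∧
      res s b' ≠ (f b' h').can b η (res s b)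

/-- The level `c`: all branches except possibly for one. -/
def stepLev (η : K → Bool) : Set (K → Bool) :=
  {s | res s c = s ∧ (∀ b (h : b < c), res s b ∈ (f b h).Lev η) ∧ ¬ O.StepDropped c f η s}

/-- `z` extends the vector of nodes of height `m` that is guessed at `m`, and passes through the
set of vectors guessed at `c`. -/
def StepGood (m : K) (z : L → K → Bool) : Prop :=
  -- The guess at `m` lives in λ, so it can name the base point `b₀` only by its index; indices are
  -- injective along a ladder.
  ∃ hm : m < c, ∃ b₀, ∃ h₀ : b₀ < c, b₀ ∈ O.D c ∧ O.idx b₀ = (O.v (O.idx m)).1 ∧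
    (∀ j o, (O.v (O.idx m)).2 j = some o →
      z j ∈ O.stepLev c f (O.guessSeq c j) ∧
      res (z j) m = (f m hm).can b₀ (O.guessSeq c j)
        (enumOf L ((f b₀ h₀).Lev (O.guessSeq c j)) o)) ∧
    ∃ d, ∃ hd : d < c, ∃ l, Sum.inr l ∈ O.Φ c d ∧ ∀ j o, O.w l j = some o →
      res (z j) d = enumOf L ((f d hd).Lev (O.guessSeq c j)) o

open Classical in
/-- A vector as in `StepGood`, if there is any. -/
noncomputable def stepVec (m : K) : L → K → Bool :=
  -- The choice involves neither η nor a particular node: it is what lets the different trees act in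
  -- concert.
  if h : ∃ z, O.StepGood c f m z then h.choose else fun _ _ => false

/-- The requirements on the `j`-th coordinate of the guessed vector to be used for `y`. -/
def StepMatch (m : K) (η y : K → Bool) (j : L) : Prop :=
  (O.v (O.idx m)).2 j ≠ none ∧ res (O.guessSeq c j) c = res η c ∧
    res (O.stepVec c f m j) m = y ∧ O.stepVec c f m j ∈ O.stepLev c f η

open Classical in
/-- The chosen extension to level `c` of a node `y` of height `m`. -/
noncomputable def stepChoice (m : K) (η y : K → Bool) : K → Bool :=
  -- Several `j` may match when the guessed sequences agree below `c`; uniqueness is needed only for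
  -- `c` so large that they differ.
  if h : ∃ j, O.StepMatch c f m η y j then O.stepVec c f m h.choose
  else if h : ∃ z ∈ O.stepLev c f η, res z m = y then h.choose else fun _ => false

open Classical in
/-- The canonical extension to level `c` of a node `x` of height `b`. -/
noncomputable def stepCan (b : K) (η x : K → Bool) : K → Bool :=
  -- With this convention the formula for a ladder with maximum `m` also covers nodes at `m` itself.
  if b = c then x
  else if h : ∃ m, ∃ _ : m < c, m ∈ O.D c ∧ ∀ b' ∈ O.D c, b' ≤ m then
    O.stepChoice c f h.choose η ((f h.choose h.choose_spec.choose).can b η x)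
  else if h : ∃ s, res s c = s ∧
      ∀ b' (h' : b' < c), b' ∈ O.D c → b < b' → res s b' = (f b' h').can b η x then
    h.choose
  else fun _ => false

/-- The data at `c`, computed from the data below `c`. -/
noncomputable def step : LevelData K where
  -- Cutting η at `c` makes a guess of η below `c` enough to know all levels up to `c`.
  Lev η := O.stepLev c f (res η c)
  can b η x := O.stepCan c f b (res η c) x

end Step

/-- The data at all levels, by recursion. -/
noncomputable def data [WellFoundedLT K] : K → LevelData K :=
  (wellFounded_lt (α := K)).fix O.step

variable [WellFoundedLT K]

theorem data_eq (c : K) : O.data c = O.step c fun b _ => O.data b :=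
  (wellFounded_lt (α := K)).fix_eq O.step c

/-- The level `c` of the tree with index `η`. -/
noncomputable def Lev (c : K) (η : K → Bool) : Set (K → Bool) := (O.data c).Lev η

/-- The canonical extension to level `c` of a node `x` of height `b` in the tree with
index `η`. -/
noncomputable def can (c b : K) (η x : K → Bool) : K → Bool := (O.data c).can b η x

theorem Lev_eq (c : K) (η : K → Bool) :
    O.Lev c η = O.stepLev c (fun b _ => O.data b) (res η c) := by
  rw [Lev, data_eq]; rfl

theorem can_eq (c b : K) (η x : K → Bool) :
    O.can c b η x = O.stepCan c (fun b _ => O.data b) b (res η c) x := by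
  rw [can, data_eq]; rfl

theorem Lev_res (c : K) (η : K → Bool) : O.Lev c (res η c) = O.Lev c η := by
  rw [Lev_eq, Lev_eq, res_res_self]

theorem can_res (c b : K) (η x : K → Bool) : O.can c b (res η c) x = O.can c b η x := by
  rw [can_eq, can_eq, res_res_self]

theorem Lev_congr {b c : K} {η η' : K → Bool} (h : res η c = res η' c) (hb : b ≤ c) :
    O.Lev b η = O.Lev b η' := by
  rw [← Lev_res, res_eq_of_le h hb, Lev_res]

theorem can_congr {b c : K} {η η' : K → Bool} (h : res η c = res η' c) (hb : b ≤ c) (a : K)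
    (x : K → Bool) : O.can b a η x = O.can b a η' x := by
  rw [← can_res, res_eq_of_le h hb, can_res]

/-- `s` is the branch that does not extend to level `c`. -/
def Dropped (c : K) (η s : K → Bool) : Prop :=
  O.Cof c ∧ (∀ b ∈ O.D c, b < c → res s b = enumOf L (O.Lev b η) (O.F (O.idx c) (O.idx b))) ∧
    ∀ b ∈ O.D c, b < c → ∃ b' ∈ O.D c, b' < c ∧ b < b' ∧ res s b' ≠ O.can b' b η (res s b)

/-- Cutting η at `c` is invisible at levels below `c`, so the recursion clause may be read with the
final `Lev` and `can`. -/
theorem mem_Lev {c : K} {η s : K → Bool} :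
    s ∈ O.Lev c η ↔ res s c = s ∧ (∀ b < c, res s b ∈ O.Lev b η) ∧ ¬ O.Dropped c η s := by
  have e₁ : ∀ b < c, (O.data b).Lev (res η c) = O.Lev b η := fun b hb =>
    O.Lev_congr (res_res_self η c) hb.le
  have e₂ : ∀ b < c, ∀ a x, (O.data b).can a (res η c) x = O.can b a η x := fun b hb a x =>
    O.can_congr (res_res_self η c) hb.le a x
  have e : O.StepDropped c (fun b _ => O.data b) (res η c) s ↔ O.Dropped c η s := by
    unfold StepDropped Dropped
    refine and_congr_right fun _ => and_congr ?_ ?_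
    · exact ⟨fun h b hb hc => by rw [h b hc hb, e₁ b hc], fun h b hc hb => by
        rw [h b hb hc, ← e₁ b hc]⟩
    · constructor
      · intro h b hb hc
        obtain ⟨b', h₁, h₂, h₃, h₄⟩ := h b hc hb
        exact ⟨b', h₂, h₁, h₃, by rwa [← e₂ b' h₁]⟩
      · intro h b hc hb
        obtain ⟨b', h₂, h₁, h₃, h₄⟩ := h b hb hc
        exact ⟨b', h₁, h₂, h₃, by rwa [e₂ b' h₁]⟩
  rw [Lev_eq, stepLev, mem_ofPred_eq, e]
  refine and_congr_right fun _ => and_congr_left fun _ => ?_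
  exact forall₂_congr fun b hb => by rw [e₁ b hb]

/-- `z` extends the vector of nodes of height `m` that is guessed at `m`, and passes through the
set of vectors guessed at `c`. -/
def Good (c m : K) (z : L → K → Bool) : Prop :=
  m < c ∧ ∃ b₀ ∈ O.D c, b₀ < c ∧ O.idx b₀ = (O.v (O.idx m)).1 ∧
    (∀ j o, (O.v (O.idx m)).2 j = some o →
      z j ∈ O.Lev c (O.guessSeq c j) ∧
      res (z j) m = O.can m b₀ (O.guessSeq c j) (enumOf L (O.Lev b₀ (O.guessSeq c j)) o)) ∧
    ∃ d < c, ∃ l, Sum.inr l ∈ O.Φ c d ∧ ∀ j o, O.w l j = some o →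
      res (z j) d = enumOf L (O.Lev d (O.guessSeq c j)) o

theorem stepGood_iff {c m : K} {z : L → K → Bool} :
    O.StepGood c (fun b _ => O.data b) m z ↔ O.Good c m z := by
  have e (j : L) : O.stepLev c (fun b _ => O.data b) (O.guessSeq c j) =
      O.Lev c (O.guessSeq c j) := by
    rw [Lev_eq, res_guessSeq]
  simp only [StepGood, Good, e]
  constructor
  · rintro ⟨hm, b₀, h₀, h₁, h₂, h₃, d, hd, h₄⟩
    exact ⟨hm, b₀, h₁, h₀, h₂, h₃, d, hd, h₄⟩
  · rintro ⟨hm, b₀, h₁, h₀, h₂, h₃, d, hd, h₄⟩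
    exact ⟨hm, b₀, h₀, h₁, h₂, h₃, d, hd, h₄⟩

/-- The vector chosen at `c`. -/
noncomputable def vec (c m : K) : L → K → Bool := O.stepVec c (fun b _ => O.data b) m

theorem good_vec {c m : K} (h : ∃ z, O.Good c m z) : O.Good c m (O.vec c m) := by
  simp only [← stepGood_iff] at h ⊢
  rw [vec, stepVec, dif_pos h]
  exact h.choose_spec

/-- The requirements on the `j`-th coordinate of the guessed vector to be used for `y`. -/
def Match (c m : K) (η y : K → Bool) (j : L) : Prop :=
  (O.v (O.idx m)).2 j ≠ none ∧ O.guessSeq c j = res η c ∧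
    res (O.vec c m j) m = y ∧ O.vec c m j ∈ O.Lev c η

/-- The chosen extension to level `c` of a node `y` of height `m`. -/
noncomputable def choice (c m : K) (η y : K → Bool) : K → Bool :=
  O.stepChoice c (fun b _ => O.data b) m (res η c) y

theorem choice_match {c m : K} {η y : K → Bool} (h : ∃ j, O.Match c m η y j) :
    ∃ j, O.Match c m η y j ∧ O.choice c m η y = O.vec c m j := by
  have e (j : L) : O.StepMatch c (fun b _ => O.data b) m (res η c) y j ↔ O.Match c m η y j := by
    simp only [StepMatch, Match, res_guessSeq, res_res_self, Lev_eq, vec]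
  simp only [← e] at h ⊢
  rw [choice, stepChoice, dif_pos h]
  exact ⟨h.choose, h.choose_spec, rfl⟩

/-- A match includes membership in the level and the correct restriction, so a wrong guess may
redirect the choice but cannot spoil it. -/
theorem choice_spec {c m : K} {η y : K → Bool} (h : ∃ z ∈ O.Lev c η, res z m = y) :
    O.choice c m η y ∈ O.Lev c η ∧ res (O.choice c m η y) m = y := by
  by_cases h' : ∃ j, O.Match c m η y j
  · obtain ⟨j, hj, e⟩ := O.choice_match h'
    rw [e]
    exact ⟨hj.2.2.2, hj.2.2.1⟩
  · have e (j : L) : O.StepMatch c (fun b _ => O.data b) m (res η c) y j ↔ O.Match c m η y j := by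
      simp only [StepMatch, Match, res_guessSeq, res_res_self, Lev_eq, vec]
    simp only [← e] at h'
    rw [Lev_eq] at h ⊢
    rw [choice, stepChoice, dif_neg h', dif_pos h]
    exact h.choose_spec

theorem can_self (c : K) (η x : K → Bool) : O.can c c η x = x := by
  rw [can_eq, stepCan, if_pos rfl]

theorem can_of_max {c m b : K} (hb : b < c) (hmc : m < c) (hm : m ∈ O.D c)
    (hmax : ∀ b' ∈ O.D c, b' ≤ m) (η x : K → Bool) :
    O.can c b η x = O.choice c m η (O.can m b η x) := by
  have h : ∃ m, ∃ _ : m < c, m ∈ O.D c ∧ ∀ b' ∈ O.D c, b' ≤ m := ⟨m, hmc, hm, hmax⟩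
  have e : h.choose = m :=
    le_antisymm (hmax _ h.choose_spec.choose_spec.1) (h.choose_spec.choose_spec.2 m hm)
  rw [can_eq, stepCan, if_neg hb.ne, dif_pos h]
  change O.stepChoice c _ h.choose (res η c) (O.can h.choose b (res η c) x) = _
  rw [e, O.can_congr (res_res_self η c) hmc.le, choice]

theorem can_of_noMax {c b : K} (hb : b < c) (hno : ¬ ∃ m ∈ O.D c, ∀ b' ∈ O.D c, b' ≤ m)
    {η x : K → Bool}
    (hs : ∃ s, res s c = s ∧ ∀ b' < c, b' ∈ O.D c → b < b' → res s b' = O.can b' b η x) :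
    res (O.can c b η x) c = O.can c b η x ∧
      ∀ b' < c, b' ∈ O.D c → b < b' → res (O.can c b η x) b' = O.can b' b η x := by
  have h₁ : ¬ ∃ m, ∃ _ : m < c, m ∈ O.D c ∧ ∀ b' ∈ O.D c, b' ≤ m :=
    fun ⟨m, _, h⟩ => hno ⟨m, h⟩
  have e : ∀ b' < c, O.can b' b (res η c) x = O.can b' b η x := fun b' hb' =>
    O.can_congr (res_res_self η c) hb'.le b x
  have hs' : ∃ s, res s c = s ∧ ∀ b', ∀ _ : b' < c, b' ∈ O.D c → b < b' →
      res s b' = O.can b' b (res η c) x := by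
    obtain ⟨s, h, h'⟩ := hs
    exact ⟨s, h, fun b' hb' h₁ h₂ => by rw [h' b' hb' h₁ h₂, e b' hb']⟩
  have key : O.can c b η x = hs'.choose := by
    rw [can_eq, stepCan, if_neg hb.ne, dif_neg h₁]
    exact dif_pos hs'
  rw [key]
  refine ⟨hs'.choose_spec.1, fun b' hb' h₁ h₂ => ?_⟩
  rw [hs'.choose_spec.2 b' hb' h₁ h₂, e b' hb']

end Oracle

end Construction

/-! ### Requirements on the guessing data; normality and coherence of canonical extensions. -/

section Construction

open Set

variable {K L : Type u} [LinearOrder K]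

namespace Oracle

/-- The ladder at `a` is long enough to meet all the guesses. -/
structure Long (O : Oracle K L) (a : K) : Prop where
  cof : O.Cof a
  bdd : ∀ B ⊆ O.D a, #B < #L → ∃ b₀ ∈ O.D a, ∀ b ∈ B, b ≤ b₀
  -- Used with `f` naming the restrictions of a branch and `h` locating its deviations from
  -- canonical extensions; level `c` then drops the branch.
  diamond : ∀ (f : K → L) (h : K → K), (∀ b ∈ O.D a, h b ∈ O.D a) →
    ∃ c ∈ O.D a, O.Cof c ∧ (∀ b ∈ O.D c, h b < c) ∧
      ∀ b ∈ O.D c, O.F (O.idx c) (O.idx b) = f b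
  guess : ∀ b ∈ O.D a, ∀ p : L × (L → Option L), #{j | p.2 j ≠ none} < #L →
    ∃ m ∈ O.D a, b < m ∧ O.v (O.idx m) = p

/-- The properties of the data that the construction needs. -/
structure Valid (O : Oracle K L) : Prop where
  lt : ∀ {a b}, b ∈ O.D a → b < a
  coh : ∀ {a b}, b ∈ O.D a → O.D b = O.D a ∩ Iio b
  idx_inj : ∀ {a b b'}, b ∈ O.D a → b' ∈ O.D a → O.idx b = O.idx b' → b = b'
  max_or_cof : ∀ {a}, (O.D a).Nonempty → (∃ m ∈ O.D a, ∀ b ∈ O.D a, b ≤ m) ∨ O.Cof a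
  omega_seq : ∀ {a}, Order.IsSuccLimit a → ¬ O.Cof a →
    ∃ c : ℕ → K, StrictMono c ∧ (∀ n, c n < a) ∧ ∀ x < a, ∃ n, x < c n
  short_or_long : ∀ {a}, Order.IsSuccLimit a →
    (∃ C ⊆ Iio a, #C < #L ∧ ∀ x < a, ∃ y ∈ C, x < y) ∨ O.Long a
  guess : ∀ (Ψ : K → Set (L ⊕ L)) (E : Set K), IsClub E →
    ∃ a, Order.IsSuccLimit a ∧ O.Long a ∧ O.D a ⊆ E ∧ ∀ c ∈ O.D a, ∀ d < c, O.Φ c d = Ψ d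
  exists_w : ∀ g : L → Option L, #{j | g j ≠ none} < #L → ∃ l, O.w l = g
  aleph0_le : ℵ₀ ≤ #L
  pow_le : ∀ ι : Type u, #ι < #L → #(ι → L) ≤ #L
  mk_Iio_le : ∀ a : K, #(Iio a) ≤ #L
  bdd : ∀ (ι : Type u) (f : ι → K), #ι ≤ #L → ∃ b, ∀ i, f i < b

variable {O : Oracle K L}

theorem Valid.mem_D (hO : O.Valid) {a b b' : K} (hb : b ∈ O.D a) (hb' : b' ∈ O.D a) (h : b < b') :
    b ∈ O.D b' := by
  rw [hO.coh hb']; exact ⟨hb, h⟩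

theorem Valid.mem_D_of_mem (hO : O.Valid) {a b b' : K} (hb' : b' ∈ O.D a) (hb : b ∈ O.D b') :
    b ∈ O.D a := by
  rw [hO.coh hb'] at hb; exact hb.1

variable [WellFoundedLT K]

theorem res_of_mem_Lev {c : K} {η s : K → Bool} (h : s ∈ O.Lev c η) : res s c = s :=
  (O.mem_Lev.1 h).1

theorem res_mem_Lev {b c : K} {η s : K → Bool} (h : s ∈ O.Lev c η) (hb : b ≤ c) :
    res s b ∈ O.Lev b η := by
  rcases hb.eq_or_lt with rfl | hb
  · rwa [res_of_mem_Lev h]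
  · exact (O.mem_Lev.1 h).2.1 b hb

variable (O) in
/-- Every node below `c` extends to level `c`. -/
def NormalAt (c : K) : Prop :=
  ∀ (η : K → Bool), ∀ b < c, ∀ x ∈ O.Lev b η, ∃ y ∈ O.Lev c η, res y b = x

variable (O) in
/-- The canonical extensions to level `c` are coherent. -/
def CanAt (c : K) : Prop :=
  ∀ (η : K → Bool), ∀ b ∈ O.D c, ∀ x ∈ O.Lev b η,
    O.can c b η x ∈ O.Lev c η ∧ res (O.can c b η x) b = x ∧
    ∀ b' ∈ O.D c, b < b' → res (O.can c b η x) b' = O.can b' b η x ∧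
      O.can c b' η (O.can b' b η x) = O.can c b η x

namespace Valid

variable (hO : O.Valid)
include hO

/-- Canonical extensions to `c` factor through `m`, so coherence is inherited from `m`; normality at
`c` guarantees that there is something to choose. -/
theorem canAt_of_max {c m : K} (hm : m ∈ O.D c) (hmax : ∀ b ∈ O.D c, b ≤ m)
    (ih : O.CanAt m) (hN : O.NormalAt c) : O.CanAt c := by
  intro η b hb x hx
  have key : ∀ b ∈ O.D c, ∀ x ∈ O.Lev b η, O.can m b η x ∈ O.Lev m η ∧
      res (O.can m b η x) b = x := by
    intro b hb x hx
    rcases (hmax b hb).eq_or_lt with rfl | h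
    · rw [can_self]; exact ⟨hx, res_of_mem_Lev hx⟩
    · exact ⟨(ih η b (hO.mem_D hb hm h) x hx).1, (ih η b (hO.mem_D hb hm h) x hx).2.1⟩
  have e : ∀ b ∈ O.D c, ∀ x, O.can c b η x = O.choice c m η (O.can m b η x) := fun b hb x =>
    O.can_of_max (hO.lt hb) (hO.lt hm) hm hmax η x
  obtain ⟨k₁, k₂⟩ := key b hb x hx
  obtain ⟨h₁, h₂⟩ := O.choice_spec (hN η m (hO.lt hm) _ k₁)
  rw [← e b hb] at h₁ h₂
  refine ⟨h₁, ?_, fun b' hb' hbb' => ?_⟩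
  · rw [← res_res_of_le _ (hmax b hb), h₂, k₂]
  · rcases (hmax b' hb').eq_or_lt with rfl | h
    · exact ⟨h₂, by rw [e _ hm, e b hb, can_self]⟩
    · have := (ih η b (hO.mem_D hb hm (hbb'.trans h)) x hx).2.2 b' (hO.mem_D hb' hm h) hbb'
      refine ⟨?_, ?_⟩
      · rw [← res_res_of_le _ h.le, h₂, this.1]
      · rw [e b' hb', this.2, ← e b hb]

/-- By induction the canonical extensions to the ladder points below `c` cohere, and their union is
the canonical extension to `c`. -/
theorem canAt_of_noMax {c : K} (hno : ¬ ∃ m ∈ O.D c, ∀ b ∈ O.D c, b ≤ m)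
    (ih : ∀ b < c, O.CanAt b) : O.CanAt c := by
  have main : ∀ η, ∀ b ∈ O.D c, ∀ x ∈ O.Lev b η, res (O.can c b η x) c = O.can c b η x ∧
      ∀ b' ∈ O.D c, b < b' → res (O.can c b η x) b' = O.can b' b η x := by
    intro η b hb x hx
    obtain ⟨s, hs, hs'⟩ := exists_glue (ι := {b' : K // b' ∈ O.D c ∧ b < b'}) (c := c)
      Subtype.val (fun b' => O.can b' b η x) (fun i => (hO.lt i.2.1).le) (by
        rintro ⟨i, hi, hbi⟩ ⟨j, hj, hbj⟩ (hij : i ≤ j)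
        have hi' := ih i (hO.lt hi) η b (hO.mem_D hb hi hbi) x hx
        rcases hij.eq_or_lt with rfl | hij
        · exact res_of_mem_Lev hi'.1
        · exact ((ih j (hO.lt hj) η b (hO.mem_D hb hj hbj) x hx).2.2 i
            (hO.mem_D hi hj hij) hbi).1)
    obtain ⟨h₁, h₂⟩ := O.can_of_noMax (hO.lt hb) hno (η := η) (x := x)
      ⟨s, hs, fun b' _ hb' h => hs' ⟨b', hb', h⟩⟩
    exact ⟨h₁, fun b' hb' h => h₂ b' (hO.lt hb') hb' h⟩
  intro η b hb x hx
  have hcof : O.Cof c := (hO.max_or_cof ⟨b, hb⟩).resolve_left hno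
  have above : ∀ d < c, ∃ b' ∈ O.D c, d < b' ∧ b < b' := fun d hd => by
    obtain ⟨b', hb', h⟩ := hcof.2 (max d b) (max_lt hd (hO.lt hb))
    exact ⟨b', hb', (le_max_left _ _).trans_lt h, (le_max_right _ _).trans_lt h⟩
  have canb : ∀ b' ∈ O.D c, b < b' → O.can b' b η x ∈ O.Lev b' η ∧ res (O.can b' b η x) b = x :=
    fun b' hb' h => ⟨(ih b' (hO.lt hb') η b (hO.mem_D hb hb' h) x hx).1,
      (ih b' (hO.lt hb') η b (hO.mem_D hb hb' h) x hx).2.1⟩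
  obtain ⟨h₁, h₂⟩ := main η b hb x hx
  have h₃ : res (O.can c b η x) b = x := by
    obtain ⟨b', hb', -, h⟩ := above b (hO.lt hb)
    rw [← res_res_of_le _ h.le, h₂ b' hb' h, (canb b' hb' h).2]
  refine ⟨O.mem_Lev.2 ⟨h₁, fun d hd => ?_, ?_⟩, h₃, fun b' hb' hbb' => ⟨h₂ b' hb' hbb', ?_⟩⟩
  · obtain ⟨b', hb', hdb, h⟩ := above d hd
    rw [← res_res_of_le _ hdb.le, h₂ b' hb' h]
    exact res_mem_Lev (canb b' hb' h).1 hdb.le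
  -- Beyond `b` the glued branch never deviates from the canonical extension of `x`, so it is not
  -- dropped.
  · rintro ⟨-, -, hd⟩
    obtain ⟨b', hb', -, h, hne⟩ := hd b hb (hO.lt hb)
    exact hne (by rw [h₃, h₂ b' hb' h])
  · obtain ⟨h₁', h₂'⟩ := main η b' hb' _ (canb b' hb' hbb').1
    refine eq_of_res_eq h₁' h₁ fun d hd => ?_
    obtain ⟨e, he, hde⟩ := hcof.2 (max d b') (max_lt hd (hO.lt hb'))
    have hb'e := (le_max_right _ _).trans_lt hde
    refine ⟨e, (le_max_left _ _).trans_lt hde, ?_⟩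
    rw [h₂' e he hb'e, h₂ e he (hbb'.trans hb'e)]
    exact ((ih e (hO.lt he) η b (hO.mem_D hb he (hbb'.trans hb'e)) x hx).2.2 b'
      (hO.mem_D hb' he hb'e) hbb').2

theorem normalAt_of_cof {c : K} (hcof : O.Cof c) (hC : O.CanAt c)
    (ih : ∀ b < c, O.NormalAt b) : O.NormalAt c := by
  intro η b hb x hx
  obtain ⟨b', hb', h⟩ := hcof.2 b hb
  obtain ⟨x', hx', rfl⟩ := ih b' (hO.lt hb') η b h x hx
  refine ⟨O.can c b' η x', (hC η b' hb' x' hx').1, ?_⟩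
  rw [← res_res_of_le _ h.le, (hC η b' hb' x' hx').2.1]

omit hO in
theorem mem_Lev_of_not_cof {c : K} (hcof : ¬ O.Cof c) {η s : K → Bool} (hs : res s c = s)
    (h : ∀ x < c, ∃ b, x < b ∧ res s b ∈ O.Lev b η) : s ∈ O.Lev c η := by
  refine O.mem_Lev.2 ⟨hs, fun b hb => ?_, fun h => hcof h.1⟩
  obtain ⟨b', h', hm⟩ := h b hb
  rw [← res_res_of_le _ h'.le]
  exact res_mem_Lev hm h'.le

/-- Nothing is dropped at `c`, and a limit `c` of this kind has countable cofinality, so an ω-chain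
of extensions can be glued. -/
theorem normalAt_of_not_cof {c : K} (hcof : ¬ O.Cof c)
    (ih : ∀ b < c, O.NormalAt b) : O.NormalAt c := by
  intro η b hb x hx
  by_cases hc : Order.IsSuccLimit c
  · obtain ⟨a, ha, hac, hacof⟩ := hO.omega_seq hc hcof
    obtain ⟨n₀, hn₀⟩ := hacof b hb
    have hx₀ : ∃ y ∈ O.Lev (a n₀) η, res y b = x := ih _ (hac n₀) η b hn₀ x hx
    obtain ⟨y₀, hy₀, hyx⟩ := hx₀
    have step : ∀ n (y : O.Lev (a (n₀ + n)) η), ∃ y' : O.Lev (a (n₀ + (n + 1))) η,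
        res y'.1 (a (n₀ + n)) = y.1 := fun n y => by
      obtain ⟨y', h, e⟩ := ih _ (hac (n₀ + (n + 1))) η (a (n₀ + n)) (ha (by omega)) y.1 y.2
      exact ⟨⟨y', h⟩, e⟩
    choose g hg using step
    let y : ∀ n, O.Lev (a (n₀ + n)) η := fun n => Nat.rec ⟨y₀, hy₀⟩ g n
    have hy : ∀ n, res (y (n + 1)).1 (a (n₀ + n)) = (y n).1 := fun n => hg n (y n)
    have hmono : ∀ n k, res (y (n + k)).1 (a (n₀ + n)) = (y n).1 := by
      intro n k
      induction k with
      | zero => exact res_of_mem_Lev (y n).2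
      | succ k ih =>
        rw [← res_res_of_le _ (ha.monotone (by omega : n₀ + n ≤ n₀ + (n + k)))]
        exact (congrArg (res · (a (n₀ + n))) (hy (n + k))).trans ih
    obtain ⟨s, hs, hs'⟩ := exists_glue (c := c) (fun n => a (n₀ + n)) (fun n => (y n).1)
      (fun n => (hac _).le) (fun i j hij => by
        obtain ⟨k, rfl⟩ : ∃ k, j = i + k :=
          Nat.exists_eq_add_of_le (by have := ha.le_iff_le.1 hij; omega)
        exact hmono i k)
    refine ⟨s, mem_Lev_of_not_cof hcof hs fun d hd => ?_, ?_⟩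
    · obtain ⟨n, hn⟩ := hacof d hd
      exact ⟨a (n₀ + n), hn.trans_le (ha.monotone (by omega)), by rw [hs' n]; exact (y n).2⟩
    · rw [← res_res_of_le s hn₀.le]
      exact (congrArg (res · b) (hs' 0)).trans hyx
  · have hmin : ¬ IsMin c := fun h => h.not_lt hb
    have : ¬ Order.IsSuccPrelimit c := fun h => hc ⟨hmin, h⟩
    obtain ⟨d, hd⟩ := Order.not_isSuccPrelimit_iff.1 this
    have hbd : b ≤ d := not_lt.1 fun h => hd.2 h hb
    have : ∃ y ∈ O.Lev d η, res y b = x := by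
      rcases hbd.eq_or_lt with rfl | h
      · exact ⟨x, hx, res_of_mem_Lev hx⟩
      · exact ih d hd.1 η b h x hx
    obtain ⟨y, hy, e⟩ := this
    -- Here `c` is the successor of `d`; through the padding, `y` itself is the extension by the
    -- value `false`.
    refine ⟨y, O.mem_Lev.2 ⟨res_of_le (res_of_mem_Lev hy) hd.1.le, fun b' hb' => ?_,
      fun h => hcof h.1⟩, e⟩
    exact res_mem_Lev hy (not_lt.1 fun h => hd.2 h hb')

/-- The two properties need a joint induction: with a maximal ladder point, canonical extensions use
normality at `c`; with a cofinal ladder, normality at `c` uses canonical extensions. -/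
theorem normalAt_and_canAt (c : K) : O.NormalAt c ∧ O.CanAt c := by
  induction c using WellFoundedLT.induction with
  | ind c ih =>
  have ihN : ∀ b < c, O.NormalAt b := fun b hb => (ih b hb).1
  have ihC : ∀ b < c, O.CanAt b := fun b hb => (ih b hb).2
  by_cases hm : ∃ m ∈ O.D c, ∀ b ∈ O.D c, b ≤ m
  · obtain ⟨m, hm, hmax⟩ := hm
    have hN : O.NormalAt c := hO.normalAt_of_not_cof (fun h => by
      obtain ⟨b, hb, h⟩ := h.2 m (hO.lt hm)
      exact (hmax b hb).not_gt h) ihN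
    exact ⟨hN, hO.canAt_of_max hm hmax (ihC m (hO.lt hm)) hN⟩
  · have hC := hO.canAt_of_noMax hm ihC
    refine ⟨?_, hC⟩
    by_cases hcof : O.Cof c
    · exact hO.normalAt_of_cof hcof hC ihN
    · exact hO.normalAt_of_not_cof hcof ihN

theorem normalAt (c : K) : O.NormalAt c := (hO.normalAt_and_canAt c).1

theorem canAt (c : K) : O.CanAt c := (hO.normalAt_and_canAt c).2

theorem exists_extension {b c : K} (h : b ≤ c) {η x : K → Bool} (hx : x ∈ O.Lev b η) :
    ∃ y ∈ O.Lev c η, res y b = x := by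
  rcases h.eq_or_lt with rfl | h
  · exact ⟨x, hx, res_of_mem_Lev hx⟩
  · exact hO.normalAt c η b h x hx

theorem Lev_nonempty [NoMaxOrder K] (c : K) (η : K → Bool) : (O.Lev c η).Nonempty := by
  have : ∃ b : K, ∀ x, b ≤ x := by
    have hne : (univ : Set K).Nonempty := ⟨c, trivial⟩
    exact ⟨wellFounded_lt.min univ hne, fun x => wellFounded_lt.min_le (mem_univ x)⟩
  obtain ⟨b, hb⟩ := this
  -- The root: the padded empty sequence, at the least element `b`.
  have h0 : (fun _ => false) ∈ O.Lev b η := by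
    refine O.mem_Lev.2 ⟨?_, fun x hx => absurd hx (hb x).not_gt, fun h => ?_⟩
    · funext x; simp [res]
    · obtain ⟨x, hx⟩ := h.1.1
      exact (hb x).not_gt (hO.lt hx)
  obtain ⟨y, hy, -⟩ := hO.exists_extension (hb c) h0
  exact ⟨y, hy⟩

end Valid
end Oracle
end Construction

/-! ### Size of the levels, and levels that seal off dense sets of vectors. -/

section Construction

open Set

variable {K L : Type u} [LinearOrder K] [WellFoundedLT K]

/-- The points closed under a function form a club. -/
theorem isClub_closed (g : K → K) (hω : ∀ f : ℕ → K, ∃ b, ∀ n, f n ≤ b)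
    (hg : ∀ c, ∃ b, ∀ x ≤ c, g x < b) (x₀ : K) :
    IsClub {c | x₀ ≤ c ∧ ∀ b < c, g b < c} := by
  constructor
  · intro d hd hne _ a ha
    refine ⟨?_, fun b hb => ?_⟩
    · obtain ⟨x, hx⟩ := hne
      exact (hd hx).1.trans (ha.1 hx)
    · obtain ⟨x, hx, hbx⟩ := (lt_isLUB_iff ha).1 hb
      exact ((hd hx).2 b hbx).trans_le (ha.1 hx)
  · intro x
    choose G hG using hg
    let f : ℕ → K := fun n => Nat.rec (max x x₀) (fun _ y => max y (G y)) n
    have hf : ∀ n, f (n + 1) = max (f n) (G (f n)) := fun n => rfl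
    have hne : {b | ∀ n, f n ≤ b}.Nonempty := hω f
    have hm := wellFounded_lt.min_mem _ hne
    set c := wellFounded_lt.min _ hne
    refine ⟨c, ⟨(le_max_right x x₀).trans (hm 0), fun b hb => ?_⟩, (le_max_left x x₀).trans (hm 0)⟩
    have : ∃ n, b < f n := by
      by_contra! h
      exact wellFounded_lt.not_lt_min {b | ∀ n, f n ≤ b} h hb
    obtain ⟨n, hn⟩ := this
    exact (hG _ b hn.le).trans_le ((le_max_right _ _).trans ((hf n).symm.le.trans (hm (n + 1))))

open Classical in
/-- The partial function on `L` that corresponds to a function on `J` along `i`. -/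
noncomputable def codeVec {J : Type u} (i : J ↪ L) (o : J → L) (l : L) : Option L :=
  if h : ∃ j, i j = l then some (o h.choose) else none

theorem codeVec_apply {J : Type u} (i : J ↪ L) (o : J → L) (j : J) :
    codeVec i o (i j) = some (o j) := by
  have h : ∃ j', i j' = i j := ⟨j, rfl⟩
  rw [codeVec, dif_pos h, i.injective h.choose_spec]

theorem exists_of_codeVec {J : Type u} {i : J ↪ L} {o : J → L} {l : L}
    (h : codeVec i o l ≠ none) : ∃ j, i j = l := by
  by_contra hn
  exact h (dif_neg hn)

theorem exists_of_codeVec_eq_some {J : Type u} {i : J ↪ L} {o : J → L} {l x : L}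
    (h : codeVec i o l = some x) : ∃ j, i j = l ∧ o j = x := by
  obtain ⟨j, rfl⟩ := exists_of_codeVec (h.trans_ne (Option.some_ne_none x))
  rw [codeVec_apply] at h
  exact ⟨j, rfl, Option.some_injective _ h⟩

theorem mk_codeVec_lt {J : Type u} (hJ : #J < #L) (i : J ↪ L) (o : J → L) :
    #{l | codeVec i o l ≠ none} < #L := by
  refine lt_of_le_of_lt ?_ hJ
  refine (mk_le_mk_of_subset (t := range i) fun l hl => exists_of_codeVec hl).trans mk_range_le

namespace Oracle

variable {O : Oracle K L}

/-- Along a long ladder, every branch is canonical. -/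
theorem Long.exists_canonical {a : K} (ha : O.Long a) (hO : O.Valid) {η s : K → Bool}
    (hsz : ∀ b < a, #(O.Lev b η) ≤ #L) (hs : ∀ b < a, res s b ∈ O.Lev b η) :
    ∃ b ∈ O.D a, ∀ b' ∈ O.D a, b < b' → res s b' = O.can b' b η (res s b) := by
  by_contra! hcon
  have H : ∀ b, ∃ b', b ∈ O.D a → b' ∈ O.D a ∧ b < b' ∧ res s b' ≠ O.can b' b η (res s b) := by
    intro b
    by_cases hb : b ∈ O.D a
    · obtain ⟨b', h⟩ := hcon b hb
      exact ⟨b', fun _ => h⟩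
    · exact ⟨b, fun h => absurd h hb⟩
  choose h hh using H
  have H' : ∀ b, ∃ l, b ∈ O.D a → enumOf L (O.Lev b η) l = res s b := by
    obtain ⟨b₀, hb₀⟩ := ha.cof.1
    have : Nonempty L := ⟨O.idx b₀⟩
    intro b
    by_cases hb : b ∈ O.D a
    · have hmem := hs b (hO.lt hb)
      rw [← range_enumOf ⟨_, hmem⟩ (hsz b (hO.lt hb))] at hmem
      obtain ⟨l, hl⟩ := hmem
      exact ⟨l, fun _ => hl⟩
    · exact ⟨Classical.arbitrary L, fun h => absurd h hb⟩
  choose f hf using H'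
  -- The branch is guessed correctly at `c`, and closure under `h` keeps its deviations unbounded
  -- below `c`; yet `res s c` belongs to level `c`.
  obtain ⟨c, hc, hcof, hcl, hF⟩ := ha.diamond f h fun b hb => (hh b hb).1
  refine (O.mem_Lev.1 (hs c (hO.lt hc))).2.2 ⟨hcof, fun b hb hbc => ?_, fun b hb hbc => ?_⟩
  · rw [res_res_of_le _ hbc.le, hF b hb, hf b (hO.mem_D_of_mem hc hb)]
  · obtain ⟨h₁, h₂, h₃⟩ := hh b (hO.mem_D_of_mem hc hb)
    refine ⟨h b, hO.mem_D h₁ hc (hcl b hb), hcl b hb, h₂, ?_⟩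
    rwa [res_res_of_le _ hbc.le, res_res_of_le _ (hcl b hb).le]

/-- A ladder at a successor is not cofinal, so nothing is dropped and both one-step extensions
survive. -/
theorem mem_Lev_of_covBy (hO : O.Valid) {c d : K} (hcd : c ⋖ d) {η t : K → Bool}
    (ht : res t d = t) (h : res t c ∈ O.Lev c η) : t ∈ O.Lev d η := by
  refine O.mem_Lev.2 ⟨ht, fun b hb => ?_, fun hd => ?_⟩
  · have hbc : b ≤ c := not_lt.1 fun h => hcd.2 h hb
    rw [← res_res_of_le _ hbc]
    exact res_mem_Lev h hbc
  · obtain ⟨b, hb, h⟩ := hd.1.2 c hcd.1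
    exact hcd.2 h (hO.lt hb)

namespace Valid

variable (hO : O.Valid)
include hO

/-- Over a short ladder a node is determined by fewer than λ restrictions, and λ^{<λ} = λ; over a
long one, by a ladder point and its restriction there, being canonical afterwards; at a successor,
by its predecessor and one bit. -/
theorem mk_Lev_le (c : K) (η : K → Bool) : #(O.Lev c η) ≤ #L := by
  induction c using WellFoundedLT.induction with
  | ind c ih =>
  by_cases hc : Order.IsSuccLimit c
  · rcases hO.short_or_long hc with ⟨C, hC, hCL, hcof⟩ | hl
    · have e : ∀ b : C, Nonempty (O.Lev b η ↪ L) := fun b => ih b (hC b.2)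
      refine le_trans ?_ (hO.pow_le C hCL)
      refine ⟨⟨fun s b => (e b).some ⟨res s.1 b, res_mem_Lev s.2 (hC b.2).le⟩, ?_⟩⟩
      intro s t hst
      refine Subtype.ext (eq_of_res_eq (res_of_mem_Lev s.2) (res_of_mem_Lev t.2) fun x hx => ?_)
      obtain ⟨y, hy, hxy⟩ := hcof x hx
      refine ⟨y, hxy, ?_⟩
      have := (e ⟨y, hy⟩).some.injective (congrFun hst ⟨y, hy⟩)
      exact congrArg Subtype.val this
    · have hcan := fun s : O.Lev c η => hl.exists_canonical hO ih
        fun b hb => res_mem_Lev s.2 hb.le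
      choose b hb hb' using hcan
      have h₁ : #(O.Lev c η) ≤ #(Σ b : Iio c, O.Lev b η) := by
        refine ⟨⟨fun s => ⟨⟨b s, hO.lt (hb s)⟩, ⟨res s.1 (b s),
          res_mem_Lev s.2 (hO.lt (hb s)).le⟩⟩, ?_⟩⟩
        intro s t hst
        have e₁ : b s = b t := congrArg (fun x : Σ b : Iio c, O.Lev b η => x.1.1) hst
        have e₂ : res s.1 (b s) = res t.1 (b t) :=
          congrArg (fun x : Σ b : Iio c, O.Lev b η => x.2.1) hst
        refine Subtype.ext (eq_of_res_eq (res_of_mem_Lev s.2) (res_of_mem_Lev t.2) fun x hx => ?_)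
        obtain ⟨y, hy, hxy⟩ := hl.cof.2 (max x (b s)) (max_lt hx (hO.lt (hb s)))
        have hsy := (le_max_right _ _).trans_lt hxy
        refine ⟨y, (le_max_left _ _).trans_lt hxy, ?_⟩
        rw [hb' s y hy hsy, hb' t y hy (e₁ ▸ hsy), e₂, e₁]
      refine h₁.trans ?_
      rw [mk_sigma]
      refine (sum_le_sum _ (fun _ => #L) fun b : Iio c => ih b.1 b.2).trans ?_
      rw [sum_const']
      exact (mul_le_mul_left (hO.mk_Iio_le c) _).trans (mul_eq_self hO.aleph0_le).le
  · by_cases hmin : IsMin c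
    · have : (O.Lev c η).Subsingleton := fun s hs t ht =>
        eq_of_res_eq (res_of_mem_Lev hs) (res_of_mem_Lev ht) fun x hx => absurd hx hmin.not_lt
      have := mk_le_one_iff_set_subsingleton.2 this
      exact this.trans (one_le_aleph0.trans hO.aleph0_le)
    · have : ¬ Order.IsSuccPrelimit c := fun h => hc ⟨hmin, h⟩
      obtain ⟨d, hd⟩ := Order.not_isSuccPrelimit_iff.1 this
      have h₁ : #(O.Lev c η) ≤ #(O.Lev d η × ULift.{u} Bool) := by
        refine ⟨⟨fun s => ⟨⟨res s.1 d, res_mem_Lev s.2 hd.1.le⟩, ⟨s.1 d⟩⟩, ?_⟩⟩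
        intro s t hst
        have e₁ : res s.1 d = res t.1 d := congrArg (fun x => x.1.1) hst
        have e₂ : s.1 d = t.1 d := congrArg (fun x => x.2.1) hst
        refine Subtype.ext ?_
        rw [← res_of_mem_Lev s.2, ← res_of_mem_Lev t.2, res_eq_iff]
        intro x hx
        rcases (not_lt.1 fun h => hd.2 h hx : x ≤ d).eq_or_lt with rfl | h
        · exact e₂
        · exact res_eq_iff.1 e₁ x h
      refine h₁.trans ?_
      rw [mk_prod, lift_id, lift_id]
      refine (mul_le_mul' (ih d hd.1) ?_).trans (mul_eq_self hO.aleph0_le).le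
      exact mk_le_aleph0.trans hO.aleph0_le

theorem exists_enumOf {c : K} {η s : K → Bool} (hs : s ∈ O.Lev c η) :
    ∃ l, enumOf L (O.Lev c η) l = s := by
  rw [← range_enumOf ⟨_, hs⟩ (hO.mk_Lev_le c η)] at hs
  exact hs

theorem mk_vec_le {J : Type u} (hJ : #J < #L) (c : K) (η : J → K → Bool) :
    #{y : J → K → Bool | ∀ j, y j ∈ O.Lev c (η j)} ≤ #L := by
  have e : ∀ j, Nonempty (O.Lev c (η j) ↪ L) := fun j => hO.mk_Lev_le c (η j)
  refine le_trans ?_ (hO.pow_le J hJ)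
  refine ⟨⟨fun y j => (e j).some ⟨y.1 j, y.2 j⟩, fun y y' h => ?_⟩⟩
  refine Subtype.ext (funext fun j => ?_)
  exact congrArg Subtype.val ((e j).some.injective (congrFun h j))

-- There are at most λ pairs of indices, so the points where two of the sequences differ are bounded
-- in κ.
omit [WellFoundedLT K] in
theorem exists_separating {J : Type u} (hJ : #J < #L) {η : J → K → Bool}
    (hη : Function.Injective η) :
    ∃ c₀, ∀ c, c₀ < c → ∀ j j', res (η j) c = res (η j') c → j = j' := by
  have H : ∀ p : J × J, ∃ x, p.1 ≠ p.2 → η p.1 x ≠ η p.2 x := by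
    obtain ⟨b, -⟩ := hO.bdd PEmpty PEmpty.elim (by simp)
    intro p
    by_cases hp : p.1 = p.2
    · exact ⟨b, fun h => absurd hp h⟩
    · obtain ⟨x, hx⟩ := Function.ne_iff.1 (hη.ne hp)
      exact ⟨x, fun _ => hx⟩
  choose x hx using H
  obtain ⟨c₀, hc₀⟩ := hO.bdd (J × J) x (by
    rw [← mul_def]
    exact (mul_le_mul' hJ.le hJ.le).trans (mul_eq_self hO.aleph0_le).le)
  refine ⟨c₀, fun c hc j j' h => ?_⟩
  by_contra hne
  exact hx (j, j') hne (res_eq_iff.1 h _ ((hc₀ (j, j')).trans hc))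

theorem isClub_closed (g : K → K) (x₀ : K) : IsClub {c | x₀ ≤ c ∧ ∀ b < c, g b < c} := by
  refine _root_.isClub_closed g (fun f => ?_) (fun c => ?_) x₀
  · obtain ⟨b, hb⟩ := hO.bdd (ULift ℕ) (fun n => f n.down) (by simpa using hO.aleph0_le)
    exact ⟨b, fun n => (hb ⟨n⟩).le⟩
  · obtain ⟨b, hb⟩ := hO.bdd (Iio c) (fun x => g x) (hO.mk_Iio_le c)
    refine (le_total b (g c)).elim (fun h => ?_) (fun h => ?_)
    · obtain ⟨b', hb'⟩ := hO.bdd PUnit (fun _ => g c)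
        (by simpa using one_le_aleph0.trans hO.aleph0_le)
      refine ⟨b', fun x hx => ?_⟩
      rcases hx.eq_or_lt with rfl | hx
      · exact hb' ⟨⟩
      · exact (hb ⟨x, hx⟩).trans_le (h.trans (hb' ⟨⟩).le)
    · obtain ⟨b', hb'⟩ := hO.bdd PUnit (fun _ => b)
        (by simpa using one_le_aleph0.trans hO.aleph0_le)
      refine ⟨b', fun x hx => ?_⟩
      rcases hx.eq_or_lt with rfl | hx
      · exact h.trans_lt (hb' ⟨⟩)
      · exact (hb ⟨x, hx⟩).trans (hb' ⟨⟩)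

/-- For every dense set of vectors there is a level all of whose vectors pass through it. -/
theorem exists_hit {J : Type u} (hJ : #J < #L) {η : J → K → Bool}
    (hη : Function.Injective η) (U : K → Set (J → K → Bool))
    (hU : ∀ b (y : J → K → Bool), (∀ j, y j ∈ O.Lev b (η j)) →
      ∃ d, b ≤ d ∧ ∃ u ∈ U d, ∀ j, u j ∈ O.Lev d (η j) ∧ res (u j) b = y j) :
    ∃ a, ∀ z : J → K → Bool, (∀ j, z j ∈ O.Lev a (η j)) →
      ∃ d < a, (fun j => res (z j) d) ∈ U d := by
  obtain ⟨i⟩ : Nonempty (J ↪ L) := hJ.le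
  obtain ⟨c₀, hc₀⟩ := hO.exists_separating hJ hη
  -- At most λ vectors have height `b`, so one bound serves all their extensions into `U`. It is
  -- taken above `c₀`, so points closed under it also separate the sequences.
  have H : ∀ b, ∃ e, c₀ < e ∧ ∀ y : J → K → Bool, (∀ j, y j ∈ O.Lev b (η j)) →
      ∃ d, d < e ∧ b ≤ d ∧ ∃ u ∈ U d, ∀ j, u j ∈ O.Lev d (η j) ∧ res (u j) b = y j := by
    intro b
    choose d hd using fun y : {y : J → K → Bool | ∀ j, y j ∈ O.Lev b (η j)} => hU b y.1 y.2
    obtain ⟨e, he⟩ := hO.bdd _ d (hO.mk_vec_le hJ b η)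
    obtain ⟨e', he'⟩ := hO.bdd PUnit (fun _ => max e c₀)
      (by simpa using one_le_aleph0.trans hO.aleph0_le)
    have he' := he' ⟨⟩
    exact ⟨e', (le_max_right _ _).trans_lt he', fun y hy =>
      ⟨d ⟨y, hy⟩, (he _).trans ((le_max_left _ _).trans_lt he'), hd ⟨y, hy⟩⟩⟩
  choose g hgc hg using H
  -- The left summand codes the sequences `η j`; the right one codes `U d`, naming a vector by the
  -- positions of its coordinates in the enumerated levels and that list of positions by its index
  -- under `w`.
  let Ψ : K → Set (L ⊕ L) := fun d =>
    {x | (∃ j, x = Sum.inl (i j) ∧ η j d = true) ∨ ∃ l, x = Sum.inr l ∧ ∃ o : J → L,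
      O.w l = codeVec i o ∧ (fun j => enumOf L (O.Lev d (η j)) (o j)) ∈ U d}
  obtain ⟨a, -, hlong, hDE, hΦ⟩ := hO.guess Ψ _ (hO.isClub_closed g c₀)
  refine ⟨a, fun z hz => ?_⟩
  -- the initial vector
  choose b hb hbz using fun j => hlong.exists_canonical hO (fun b _ => hO.mk_Lev_le b (η j))
    fun b hb => res_mem_Lev (hz j) hb.le
  obtain ⟨b₀, hb₀, hbb₀⟩ := hlong.bdd (range b) (range_subset_iff.2 hb)
    (mk_range_le.trans_lt hJ)
  -- By coherence, being canonical from `b j` implies being canonical from the common bound `b₀`.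
  have hcan : ∀ j, ∀ b' ∈ O.D a, b₀ < b' →
      res (z j) b' = O.can b' b₀ (η j) (res (z j) b₀) := by
    intro j b' hb' h
    rcases (hbb₀ _ (mem_range_self j)).eq_or_lt with e | hlt
    · exact e ▸ hbz j b' hb' (e ▸ h)
    · rw [hbz j b' hb' (hlt.trans h), hbz j b₀ hb₀ hlt]
      exact ((hO.canAt b' (η j) (b j) (hO.mem_D (hb j) hb' (hlt.trans h)) _
        (res_mem_Lev (hz j) (hO.lt (hb j)).le)).2.2 b₀ (hO.mem_D hb₀ hb' h) hlt).2.symm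
  choose o ho using fun j => hO.exists_enumOf (res_mem_Lev (hz j) (hO.lt hb₀).le)
  obtain ⟨m, hm, hb₀m, hv⟩ := hlong.guess b₀ hb₀ (O.idx b₀, codeVec i o) (mk_codeVec_lt hJ i o)
  -- the next point of the ladder
  obtain ⟨c, hc, hmc, hmax⟩ : ∃ c ∈ O.D a, m < c ∧ ∀ b' ∈ O.D c, b' ≤ m := by
    have hne : {c | c ∈ O.D a ∧ m < c}.Nonempty := hlong.cof.2 m (hO.lt hm)
    have hmin := wellFounded_lt.min_mem _ hne
    refine ⟨_, hmin.1, hmin.2, fun b' hb' => ?_⟩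
    by_contra! h
    exact wellFounded_lt.not_lt_min {c | c ∈ O.D a ∧ m < c}
      ⟨hO.mem_D_of_mem hmin.1 hb', h⟩ (hO.lt hb')
  have hmDc := hO.mem_D hm hc hmc
  have hb₀c := hO.mem_D hb₀ hc (hb₀m.trans hmc)
  have hgm : g m < c := (hDE hc).2 m hmc
  have hseq : ∀ j, O.guessSeq c (i j) = res (η j) c := by
    intro j
    funext d
    by_cases hd : d < c
    · rw [res_apply_of_lt hd, Bool.eq_iff_iff]
      simp only [guessSeq, decide_eq_true_eq, hd, true_and, hΦ c hc d hd]
      constructor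
      · rintro (⟨j', h, h'⟩ | ⟨l, h, -⟩)
        · rwa [i.injective (Sum.inl_injective h)]
        · cases h
      · exact fun h => Or.inl ⟨j, rfl, h⟩
    · simp [guessSeq, res, hd]
  have hLev : ∀ j, ∀ d ≤ c, O.Lev d (O.guessSeq c (i j)) = O.Lev d (η j) := fun j d hd =>
    O.Lev_congr (by rw [hseq, res_res_self]) hd
  -- Density applied to the restriction of `z` to `m` gives a vector in `U` below `g m < c`, and
  -- normality lifts it to level `c`.
  have hgood : ∃ z', O.Good c m z' := by
    obtain ⟨d, hdg, hmd, u, huU, hu⟩ := hg m (fun j => res (z j) m)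
      fun j => res_mem_Lev (hz j) (hO.lt hm).le
    have hdc := hdg.trans hgm
    choose y hy hyu using fun j => hO.exists_extension hdc.le (hu j).1
    choose o' ho' using fun j => hO.exists_enumOf (hu j).1
    obtain ⟨l, hl⟩ := hO.exists_w _ (mk_codeVec_lt hJ i o')
    have hext : ∀ j, Function.extend i y (fun _ _ => false) (i j) = y j := fun j =>
      i.injective.extend_apply _ _ j
    refine ⟨Function.extend i y fun _ _ => false, hmc, b₀, hb₀c, hO.lt hb₀c, by rw [hv], ?_,
      d, hdc, l, ?_, ?_⟩
    · intro l' o'' hl'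
      rw [hv] at hl'
      obtain ⟨j, rfl, rfl⟩ := exists_of_codeVec_eq_some hl'
      rw [hext, hLev j c le_rfl, hLev j b₀ (hO.lt hb₀c).le, ho]
      refine ⟨hy j, ?_⟩
      rw [← res_res_of_le _ hmd, hyu, (hu j).2, hcan j m hm hb₀m]
      exact (O.can_congr (by rw [hseq, res_res_self]) hmc.le _ _).symm
    · rw [hΦ c hc d hdc]
      exact Or.inr ⟨l, rfl, o', hl, by simpa only [ho'] using huU⟩
    · intro l' o'' hl'
      rw [hl] at hl'
      obtain ⟨j, rfl, rfl⟩ := exists_of_codeVec_eq_some hl'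
      rw [hext, hyu, hLev j d hdc.le, ho']
  obtain ⟨-, b₁, hb₁, -, hb₁', hvec, d, hdc, l, hlΦ, hld⟩ := O.good_vec hgood
  rw [hv] at hb₁' hvec
  obtain rfl := hO.idx_inj hb₁ hb₀c hb₁'
  -- Since `m` is the last ladder point before `c`, `z j` follows the choice made at `c`. The match
  -- found there may have another index, but `c` is above `c₀`, so it can only be `j`.
  have hzc : ∀ j, res (z j) c = O.vec c m (i j) := by
    intro j
    obtain ⟨hv₁, hv₂⟩ := hvec (i j) (o j) (codeVec_apply i o j)
    rw [hLev j c le_rfl] at hv₁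
    rw [hLev j _ (hO.lt hb₁).le, ho,
      O.can_congr (η' := η j) (by rw [hseq, res_res_self]) hmc.le,
      ← hcan j m hm hb₀m] at hv₂
    have hmatch : ∃ j', O.Match c m (η j) (res (z j) m) j' :=
      ⟨i j, by rw [hv]; simp [codeVec_apply], hseq j, hv₂, hv₁⟩
    obtain ⟨j', hj', e⟩ := O.choice_match hmatch
    rw [hcan j c hc (hb₀m.trans hmc), O.can_of_max (hO.lt hb₁) hmc hmDc hmax, ← hcan j m hm hb₀m, e]
    have hne := hj'.1
    rw [hv] at hne
    obtain ⟨j'', rfl⟩ := exists_of_codeVec hne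
    rw [hc₀ c ((hgc m).trans hgm) j'' j ((hseq j'').symm.trans hj'.2.1)]
  rw [hΦ c hc d hdc] at hlΦ
  rcases hlΦ with ⟨j, h, -⟩ | ⟨l', h, o', hw, ho'⟩
  · cases h
  · obtain rfl := Sum.inr_injective h
    refine ⟨d, hdc.trans (hO.lt hc), ?_⟩
    convert ho' using 2 with j
    rw [← res_res_of_le _ hdc.le, hzc, hld (i j) (o' j) (by rw [hw, codeVec_apply]),
      hLev j d hdc.le]

end Valid
end Oracle
end Construction

/-! ### Accumulation points of clubs and closure in regular cardinals. -/

section Ladders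

open Set

section General

variable {K : Type u} [LinearOrder K]

theorem isSuccLimit_of_mem_accPoints {S : Set K} {b : K} (h : b ∈ accPoints S) :
    Order.IsSuccLimit b := by
  refine ⟨h.2.1, fun c hc => ?_⟩
  obtain ⟨x, hx, hcx⟩ := (lt_isLUB_iff h.2.2).1 hc.1
  exact hc.2 hcx hx.2

theorem accPoints_inter_Iio {S : Set K} {b : K} :
    accPoints (S ∩ Iio b) = accPoints S ∩ Iio b := by
  ext x
  have e (hx : x < b) : S ∩ Iio b ∩ Iio x = S ∩ Iio x := by
    rw [inter_assoc, Iio_inter_Iio, min_eq_right hx.le]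
  constructor
  · rintro ⟨⟨h₁, h₂⟩, h₃, h₄⟩
    rw [e h₂] at h₄
    exact ⟨⟨h₁, h₃, h₄⟩, h₂⟩
  · rintro ⟨⟨h₁, h₃, h₄⟩, h₂⟩
    refine ⟨⟨h₁, h₂⟩, h₃, ?_⟩
    rwa [e h₂]

theorem exists_gt_of_isClub {S : Set K} {a : K} (ha : Order.IsSuccLimit a)
    (hS : IsClub {γ : Iio a | γ.1 ∈ S}) {x : K} (hx : x < a) : ∃ y ∈ S, y < a ∧ x < y := by
  obtain ⟨x', hx', hxx'⟩ : ∃ x', x' < a ∧ x < x' := by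
    by_contra! h
    exact ha.2 x ⟨hx, fun c hc hca => (h c hca).not_gt hc⟩
  obtain ⟨y, hy, h⟩ := hS.isCofinal ⟨x', hx'⟩
  exact ⟨y, hy, y.2, hxx'.trans_le h⟩

theorem mem_accPoints_of_isLUB {S : Set K} {a d : K}
    (hS : IsClub {γ : Iio a | γ.1 ∈ S}) (hd : d < a) {T : Set K} (hT : T ⊆ S) (hTd : ∀ x ∈ T, x < d)
    (hne : T.Nonempty) (hlub : IsLUB T d) : d ∈ accPoints S := by
  refine ⟨?_, ?_, ?_, ?_⟩
  · refine hS.isLUB_mem (t := {γ : Iio a | γ.1 ∈ T}) (x := ⟨d, hd⟩) (fun x hx => hT hx) ?_ ?_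
    · obtain ⟨x, hx⟩ := hne
      exact ⟨⟨x, (hTd x hx).trans hd⟩, hx⟩
    · refine ⟨fun x hx => hlub.1 hx, fun u hu => ?_⟩
      exact hlub.2 fun x hx => hu (a := ⟨x, (hTd x hx).trans hd⟩) hx
  · obtain ⟨x, hx⟩ := hne
    exact fun h => h.not_lt (hTd x hx)
  · exact fun x hx => le_of_lt hx.2
  · exact fun u hu => hlub.2 fun x hx => hu ⟨hT hx, hTd x hx⟩

theorem exists_isLUB_le [WellFoundedLT K] {T : Set K} {x : K} (hx : ∀ t ∈ T, t ≤ x) :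
    ∃ d, IsLUB T d ∧ d ≤ x := by
  have hne : (upperBounds T).Nonempty := ⟨x, fun t ht => hx t ht⟩
  exact ⟨_, ⟨wellFounded_lt.min_mem _ hne, fun u hu => wellFounded_lt.min_le hu⟩,
    wellFounded_lt.min_le (s := upperBounds T) fun t ht => hx t ht⟩

/-- The order type of a proper initial segment. -/
theorem type_inter_Iio [WellFoundedLT K] {S : Set K} {b : K} (hb : b ∈ S) :
    Ordinal.type (α := (S ∩ Iio b : Set K)) (· < ·) =
      Ordinal.typein (α := S) (· < ·) ⟨b, hb⟩ := by
  rw [← Ordinal.type_subrel, Ordinal.type_eq]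
  exact ⟨⟨⟨fun x => ⟨⟨x.1, x.2.1⟩, x.2.2⟩, fun x => ⟨x.1.1, x.1.2, x.2⟩, fun _ => rfl,
    fun _ => rfl⟩,
    Iff.rfl⟩⟩

end General

theorem mk_Iio_ord_lt {c : Cardinal.{u}} (i : c.ord.ToType) : #(Iio i) < c := by
  simpa using mk_Iio_lt i

theorem exists_bound {c : Cardinal.{u}} (hc : c.IsRegular) (ι : Type u) (f : ι → c.ord.ToType)
    (hι : #ι < c) : ∃ b, ∀ i, f i < b := by
  have : ¬ IsCofinal (range f) := fun h => by
    have h₁ := Order.cof_le h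
    rw [Ordinal.cof_toType, hc.cof_ord] at h₁
    exact (h₁.trans mk_range_le).not_gt hι
  obtain ⟨b, hb⟩ := not_isCofinal_iff.1 this
  exact ⟨b, fun i => hb _ (mem_range_self i)⟩

theorem isClub_closed_ord {c : Cardinal.{u}} (hc : c.IsRegular) (hunc : ℵ₀ < c)
    (g : c.ord.ToType → c.ord.ToType) (x₀ : c.ord.ToType) :
    IsClub {i | x₀ ≤ i ∧ ∀ j < i, g j < i} := by
  have := Cardinal.noMaxOrder hc.1
  refine isClub_closed g (fun f => ?_) (fun i => ?_) x₀
  · obtain ⟨b, hb⟩ := exists_bound hc (ULift ℕ) (fun n => f n.down) (by simpa using hunc)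
    exact ⟨b, fun n => (hb ⟨n⟩).le⟩
  · obtain ⟨i', hi'⟩ := exists_gt i
    obtain ⟨b, hb⟩ := exists_bound hc (Iio i') (fun x => g x) (mk_Iio_ord_lt i')
    exact ⟨b, fun x hx => hb ⟨x, hx.trans_lt hi'⟩⟩

/-! ### Consequences of ◊(λ), including λ^{<λ} = λ. -/

section Diamond

variable {lam : Cardinal.{u}} (hreg : lam.IsRegular) (hunc : ℵ₀ < lam)
include hreg hunc

/-- The stationary set of correct guesses meets the club of points closed under `g` and under
successor; the latter closure makes `i` a limit. -/
theorem exists_index (F : (β : lam.ord.ToType) → Iio β → lam.ord.ToType)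
    (hF : ∀ f : lam.ord.ToType → lam.ord.ToType,
      IsStationary {β : lam.ord.ToType | ∀ γ : Iio β, f γ = F β γ})
    (f g : lam.ord.ToType → lam.ord.ToType) (x₀ : lam.ord.ToType) :
    ∃ i, Order.IsSuccLimit i ∧ x₀ < i ∧ (∀ j < i, g j < i) ∧ ∀ γ : Iio i, F i γ = f γ := by
  have := Cardinal.noMaxOrder hreg.1
  obtain ⟨x₁, hx₁⟩ := exists_gt x₀
  obtain ⟨i, h₁, h₂, h₃⟩ := hF f
    (isClub_closed_ord hreg hunc (fun j => max (g j) (Order.succ j)) x₁)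
  refine ⟨i, ⟨fun h => h.not_lt (hx₁.trans_le h₂), fun j hj => ?_⟩, hx₁.trans_le h₂,
    fun j hj => (le_max_left _ _).trans_lt (h₃ j hj), fun γ => (h₁ γ).symm⟩
  exact hj.2 (Order.lt_succ j) ((le_max_right _ _).trans_lt (h₃ j hj.1))

/-- Moved into a bounded part of λ, every function on `ι` is read off from some entry of the diamond
sequence, which has only λ entries. The value `b` is a filler. -/
theorem DiamondPrinciple.mk_fun_le (h : DiamondPrinciple lam) (ι : Type u) (hι : #ι < lam) :
    #(ι → lam.ord.ToType) ≤ #lam.ord.ToType := by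
  obtain ⟨F, hF⟩ := h
  obtain ⟨e⟩ : Nonempty (ι ↪ lam.ord.ToType) := by
    rw [← Cardinal.le_def, mk_ord_toType]; exact hι.le
  obtain ⟨b, hb⟩ := exists_bound hreg ι e hι
  refine mk_le_of_surjective (f := fun β x => if h : e x < β then F β ⟨e x, h⟩ else b) ?_
  intro g
  obtain ⟨i, -, hbi, -, hi⟩ := exists_index hreg hunc F hF (Function.extend e g fun _ => b) id b
  refine ⟨i, funext fun x => ?_⟩
  refine (dif_pos ((hb x).trans hbi)).trans ((hi _).trans ?_)
  exact e.injective.extend_apply _ _ _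

/-- By regularity a small support is bounded, so the function is coded by a bound and its values
below it; λ^{<λ} = λ counts the codes. -/
theorem DiamondPrinciple.exists_enum (h : DiamondPrinciple lam) :
    ∃ w : lam.ord.ToType → lam.ord.ToType → Option lam.ord.ToType,
      ∀ g : lam.ord.ToType → Option lam.ord.ToType, #{j | g j ≠ none} < lam → ∃ l, w l = g := by
  set L := lam.ord.ToType
  have hL : #L = lam := mk_ord_toType lam
  have hL₀ : ℵ₀ ≤ #L := hL ▸ hreg.1
  obtain ⟨o⟩ : Nonempty (Option L ≃ L) := by
    rw [← Cardinal.eq, mk_option]; exact add_one_eq hL₀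
  have hcard : #{g : L → Option L | #{j | g j ≠ none} < lam} ≤ #L := by
    have H : ∀ g : {g : L → Option L | #{j | g j ≠ none} < lam},
        ∃ b, ∀ j, g.1 j ≠ none → j < b := by
      intro g
      obtain ⟨b, hb⟩ := exists_bound hreg _ (Subtype.val : {j | g.1 j ≠ none} → L) g.2
      exact ⟨b, fun j hj => hb ⟨j, hj⟩⟩
    choose b hb using H
    have h₁ : #{g : L → Option L | #{j | g j ≠ none} < lam} ≤ #(Σ b : L, Iio b → L) := by
      refine ⟨⟨fun g => ⟨b g, fun j => o (g.1 j)⟩, fun g g' hgg' => ?_⟩⟩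
      have e₁ : b g = b g' := congrArg Sigma.fst hgg'
      have e₂ : ∀ j < b g, g.1 j = g'.1 j := by
        intro j hj
        have : ∀ x y : (Σ b : L, Iio b → L), x = y → ∀ (h : j < x.1) (h' : j < y.1),
            x.2 ⟨j, h⟩ = y.2 ⟨j, h'⟩ := by rintro x _ rfl _ _; rfl
        exact o.injective (this _ _ hgg' hj (hj.trans_eq e₁))
      refine Subtype.ext (funext fun j => ?_)
      by_cases hj : j < b g
      · exact e₂ j hj
      · have h₁ : g.1 j = none := by_contra fun h => hj (hb g j h)
        have h₂ : g'.1 j = none := by_contra fun h => hj (e₁ ▸ hb g' j h)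
        rw [h₁, h₂]
    refine h₁.trans ?_
    rw [mk_sigma]
    refine (sum_le_sum _ (fun _ => #L) fun b : L =>
      DiamondPrinciple.mk_fun_le hreg hunc h (Iio b) (mk_Iio_ord_lt b)).trans ?_
    rw [sum_const']
    exact (mul_eq_self hL₀).le
  have : Nonempty {g : L → Option L | #{j | g j ≠ none} < lam} :=
    ⟨⟨fun _ => none, by simpa using hreg.pos⟩⟩
  obtain ⟨e⟩ := hcard
  refine ⟨fun l => (Function.invFun e l).1, fun g hg => ⟨e ⟨g, hg⟩, ?_⟩⟩
  exact congrArg Subtype.val (Function.leftInverse_invFun e.injective ⟨g, hg⟩)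

end Diamond

end Ladders

/-! ### Coherent ladder systems. -/

section Ladders

open Set

variable {K : Type u} [LinearOrder K] [WellFoundedLT K]

/-- A coherent system of clubs `C a ⊆ a` of order type at most `lam`. -/
structure IsLadderSystem (lam : Cardinal.{u}) (C : K → Set K) : Prop where
  sub : ∀ {a}, Order.IsSuccLimit a → C a ⊆ Iio a
  club : ∀ {a}, Order.IsSuccLimit a → IsClub {γ : Iio a | γ.1 ∈ C a}
  type_le : ∀ {a}, Order.IsSuccLimit a → Ordinal.type (α := C a) (· < ·) ≤ lam.ord
  coh : ∀ {a}, Order.IsSuccLimit a → ∀ b ∈ accPoints (C a), C b = C a ∩ Iio b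

/-- The accumulation points of the ladder at a limit `a`. -/
def ladderAcc (C : K → Set K) (a : K) : Set K := {b | Order.IsSuccLimit a ∧ b ∈ accPoints (C a)}

open Classical in
/-- The order type of the ladder at `b`. -/
noncomputable def ladderIdx {lam : Cardinal.{u}} (C : K → Set K) (l₀ : lam.ord.ToType) (b : K) :
    lam.ord.ToType :=
  if h : Ordinal.type (α := C b) (· < ·) < lam.ord then
    Ordinal.ToType.mk (o := lam.ord) ⟨Ordinal.type (α := C b) (· < ·), h⟩
  -- Never reached at a ladder point: by coherence its club is a proper initial segment of one of
  -- type at most λ.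
  else l₀

namespace IsLadderSystem

variable {lam : Cardinal.{u}} {C : K → Set K} (hC : IsLadderSystem lam C)
include hC

theorem lt {a b : K} (h : b ∈ ladderAcc C a) : b < a := hC.sub h.1 h.2.1

theorem ladderAcc_eq {a b : K} (h : b ∈ ladderAcc C a) :
    ladderAcc C b = ladderAcc C a ∩ Iio b := by
  have hb := isSuccLimit_of_mem_accPoints h.2
  ext x
  simp only [ladderAcc, hb, h.1, true_and, hC.coh h.1 b h.2, accPoints_inter_Iio]
  rfl

/-- If the accumulation points are bounded below `a`, their supremum is again one, hence the
maximum. -/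
theorem max_or_cof {a : K} (hne : (ladderAcc C a).Nonempty) :
    (∃ m ∈ ladderAcc C a, ∀ b ∈ ladderAcc C a, b ≤ m) ∨ ∀ x < a, ∃ b ∈ ladderAcc C a, x < b := by
  by_contra! hcon
  obtain ⟨hno, x, hxa, hx⟩ := hcon
  obtain ⟨d, hd, hdx⟩ := exists_isLUB_le hx
  have hlt : ∀ b ∈ ladderAcc C a, b < d := fun b hb =>
    (hno b hb).elim fun b' h => h.2.trans_le (hd.1 h.1)
  have ha : Order.IsSuccLimit a := hne.elim fun b hb => hb.1
  obtain ⟨b, hb, h⟩ := hno d ⟨ha, mem_accPoints_of_isLUB (hC.club ha) (hdx.trans_lt hxa)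
    (fun b hb => hb.2.1) hlt hne hd⟩
  exact (hd.1 hb).not_gt h

/-- Past a bound of the accumulation points, any ω-sequence in the club is cofinal in `a`; otherwise
its supremum would be a new accumulation point. -/
theorem exists_omega_seq {a : K} (ha : Order.IsSuccLimit a)
    (h : ¬ ((ladderAcc C a).Nonempty ∧ ∀ x < a, ∃ b ∈ ladderAcc C a, x < b)) :
    ∃ c : ℕ → K, StrictMono c ∧ (∀ n, c n < a) ∧ ∀ x < a, ∃ n, x < c n := by
  have hcof := fun x hx => exists_gt_of_isClub ha (hC.club ha) (x := x) hx
  obtain ⟨x₀, hx₀, hx₀'⟩ : ∃ x₀ < a, ∀ b ∈ ladderAcc C a, b ≤ x₀ := by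
    by_contra! h'
    refine h ⟨?_, h'⟩
    obtain ⟨x, hx⟩ := not_isMin_iff.1 ha.1
    obtain ⟨b, hb, -⟩ := h' x hx
    exact ⟨b, hb⟩
  have H : ∀ x : Iio a, ∃ y : Iio a, y.1 ∈ C a ∧ x.1 < y.1 := fun x => by
    obtain ⟨y, h₁, h₂, h₃⟩ := hcof x x.2
    exact ⟨⟨y, h₂⟩, h₁, h₃⟩
  choose g hgC hg using H
  let c : ℕ → Iio a := fun n => Nat.rec (g ⟨x₀, hx₀⟩) (fun _ y => g y) n
  have hmono : StrictMono fun n => (c n).1 := strictMono_nat_of_lt_succ fun n => hg (c n)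
  have hcC : ∀ n, (c n).1 ∈ C a := by
    rintro (_ | n)
    · exact hgC _
    · exact hgC _
  refine ⟨fun n => (c n).1, hmono, fun n => (c n).2, fun x hx => ?_⟩
  by_contra! hcon
  obtain ⟨d, hd, hdx⟩ := exists_isLUB_le (T := range fun n => (c n).1) (x := x)
    (by rintro _ ⟨n, rfl⟩; exact hcon n)
  have : d ∈ ladderAcc C a := ⟨ha, mem_accPoints_of_isLUB (hC.club ha) (hdx.trans_lt hx)
    (T := range fun n => (c n).1) (by rintro _ ⟨n, rfl⟩; exact hcC n)
    (by
      rintro _ ⟨n, rfl⟩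
      exact (hmono n.lt_succ_self).trans_le (hd.1 (mem_range_self (n + 1))))
    (range_nonempty _) hd⟩
  exact (hx₀' d this).not_gt ((hg ⟨x₀, hx₀⟩).trans_le (hd.1 (mem_range_self 0)))

/-- Coherence identifies the order type of `C b` with the position of `b` in `C a`, so the index
does not depend on `a`. -/
theorem ladderIdx_eq {a b : K} (l₀ : lam.ord.ToType) (h : b ∈ ladderAcc C a) :
    Ordinal.typein (α := lam.ord.ToType) (· < ·) (ladderIdx C l₀ b) =
      Ordinal.typein (α := C a) (· < ·) ⟨b, h.2.1⟩ := by
  have e : Ordinal.type (α := C b) (· < ·) = Ordinal.typein (α := C a) (· < ·) ⟨b, h.2.1⟩ := by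
    rw [← type_inter_Iio h.2.1]
    exact congrArg (fun S : Set K => Ordinal.type (α := S) (· < ·)) (hC.coh h.1 b h.2)
  have hlt : Ordinal.type (α := C b) (· < ·) < lam.ord := by
    rw [e]
    exact (Ordinal.typein_lt_type _ _).trans_le (hC.type_le h.1)
  rw [← e, ladderIdx, dif_pos hlt]
  exact congrArg Subtype.val (Ordinal.ToType.mk.symm_apply_apply _)

theorem ladderIdx_inj {a b b' : K} {l₀ : lam.ord.ToType} (h : b ∈ ladderAcc C a)
    (h' : b' ∈ ladderAcc C a) (e : ladderIdx C l₀ b = ladderIdx C l₀ b') : b = b' := by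
  have := hC.ladderIdx_eq l₀ h
  rw [e, hC.ladderIdx_eq l₀ h'] at this
  exact (congrArg Subtype.val (Ordinal.typein_injective _ this)).symm

/-- The increasing enumeration of a ladder of order type `lam`. -/
theorem exists_enum {a : K} (ha : Order.IsSuccLimit a)
    (hty : Ordinal.type (α := C a) (· < ·) = lam.ord) (l₀ : lam.ord.ToType) :
    ∃ φ : lam.ord.ToType → K, StrictMono φ ∧ range φ = C a ∧
      (∀ i, Order.IsSuccLimit i → φ i ∈ ladderAcc C a) ∧
      ∀ i, φ i ∈ ladderAcc C a → ladderIdx C l₀ (φ i) = i := by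
  obtain ⟨e⟩ := Ordinal.type_eq.1 ((Ordinal.type_toType lam.ord).trans hty.symm)
  let φ : lam.ord.ToType → K := fun i => e i
  have hmono : StrictMono φ := fun i j h => e.map_rel_iff.2 h
  have hrange : range φ = C a := by
    ext x
    constructor
    · rintro ⟨i, rfl⟩
      exact (e i).2
    · exact fun hx => ⟨e.symm ⟨x, hx⟩, congrArg Subtype.val (e.apply_symm_apply ⟨x, hx⟩)⟩
  have hφC : ∀ i, φ i ∈ C a := fun i => hrange ▸ mem_range_self i
  refine ⟨φ, hmono, hrange, fun i hi => ⟨ha, ?_⟩, fun i hi => ?_⟩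
  · obtain ⟨d, hd, hdi⟩ := exists_isLUB_le (T := φ '' Iio i) (x := φ i)
      (by rintro _ ⟨j, hj, rfl⟩; exact (hmono hj).le)
    have hmem : d ∈ accPoints (C a) := by
      refine mem_accPoints_of_isLUB (hC.club ha) (hdi.trans_lt (hC.sub ha (hφC i)))
        (T := φ '' Iio i) (by rintro _ ⟨j, hj, rfl⟩; exact hφC j) ?_ ?_ hd
      · rintro _ ⟨j, hj, rfl⟩
        obtain ⟨k, hk, hjk⟩ : ∃ k < i, j < k := by
          by_contra! h
          exact hi.2 j ⟨hj, fun c hc hci => (h c hci).not_gt hc⟩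
        exact (hmono hjk).trans_le (hd.1 ⟨k, hk, rfl⟩)
      · obtain ⟨j, hj⟩ := not_isMin_iff.1 hi.1
        exact ⟨φ j, j, hj, rfl⟩
    obtain ⟨i', hi'⟩ : d ∈ range φ := hrange ▸ hmem.1
    have : φ i = d := by
      refine le_antisymm ?_ hdi
      rw [← hi', hmono.le_iff_le]
      by_contra! h
      have h₁ := hi.2 i'
      refine h₁ ⟨h, fun c hc hci => ?_⟩
      exact (hmono hc).not_ge (hi' ▸ hd.1 ⟨c, hci, rfl⟩)
    rwa [this]
  · have h₁ := hC.ladderIdx_eq l₀ hi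
    have h₂ : Ordinal.typein (α := C a) (· < ·) (e i) =
        Ordinal.typein (α := lam.ord.ToType) (· < ·) i :=
      Ordinal.typein_apply (r := fun x y : lam.ord.ToType => x < y) e.toInitialSeg i
    exact Ordinal.typein_injective _ (h₁.trans h₂)

end IsLadderSystem

end Ladders

/-! ### Guessing data obtained from the two diamond principles. -/

section Ladders

open Set


open Classical in
/-- The oracle given by a ladder system `C` with guesses `X`, a diamond sequence `F`, an
enumeration `w` of partial functions and a pairing function `p`. -/
noncomputable def squareOracle {lam : Cardinal.{u}}
    (C X : (Order.succ lam).ord.ToType → Set (Order.succ lam).ord.ToType)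
    (F : (β : lam.ord.ToType) → Iio β → lam.ord.ToType) (l₀ : lam.ord.ToType)
    (π : (Order.succ lam).ord.ToType × (lam.ord.ToType ⊕ lam.ord.ToType) ≃
      (Order.succ lam).ord.ToType)
    (w : lam.ord.ToType → lam.ord.ToType → Option lam.ord.ToType)
    (p : lam.ord.ToType ≃ lam.ord.ToType × lam.ord.ToType) :
    Oracle (Order.succ lam).ord.ToType lam.ord.ToType where
  D := ladderAcc C
  idx := ladderIdx C l₀
  Φ c d := {x | π (d, x) ∈ X c}
  F i j := if h : j < i then F i ⟨j, h⟩ else l₀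
  w := w
  -- A base index and a vector are coded by one element of λ, read off as the guessed value at `l₀`.
  -- Guessing constant functions thus produces every code unboundedly often.
  v i := ((p (if h : l₀ < i then F i ⟨l₀, h⟩ else l₀)).1,
    w (p (if h : l₀ < i then F i ⟨l₀, h⟩ else l₀)).2)

variable {lam : Cardinal.{u}} (hreg : lam.IsRegular) (hunc : ℵ₀ < lam)
  {C X : (Order.succ lam).ord.ToType → Set (Order.succ lam).ord.ToType}
  {F : (β : lam.ord.ToType) → Iio β → lam.ord.ToType} {l₀ : lam.ord.ToType}
  {π : (Order.succ lam).ord.ToType × (lam.ord.ToType ⊕ lam.ord.ToType) ≃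
    (Order.succ lam).ord.ToType}
  {w : lam.ord.ToType → lam.ord.ToType → Option lam.ord.ToType}
  {p : lam.ord.ToType ≃ lam.ord.ToType × lam.ord.ToType}
include hreg hunc

/-- Along the increasing enumeration φ of `C a`, limit indices give ladder points, and a ladder
point `φ i` has index `i`; so diamond on λ transfers to the ladder. -/
theorem squareOracle_long (hC : IsLadderSystem lam C)
    (hF : ∀ f : lam.ord.ToType → lam.ord.ToType,
      IsStationary {β : lam.ord.ToType | ∀ γ : Iio β, f γ = F β γ})
    (hw : ∀ g : lam.ord.ToType → Option lam.ord.ToType, #{j | g j ≠ none} < lam → ∃ l, w l = g)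
    {a : (Order.succ lam).ord.ToType} (ha : Order.IsSuccLimit a)
    (hty : Ordinal.type (α := C a) (· < ·) = lam.ord) :
    (squareOracle C X F l₀ π w p).Long a := by
  obtain ⟨φ, hmono, hrange, hacc, hidx⟩ := hC.exists_enum ha hty l₀
  have index := exists_index hreg hunc F hF
  -- the next limit index
  choose nl hnl hnl' using fun x : lam.ord.ToType =>
    (index id id x).imp fun i h => (⟨h.1, h.2.1⟩ : Order.IsSuccLimit i ∧ x < i)
  have hmem : ∀ b ∈ ladderAcc C a, ∃ i, φ i = b := fun b hb => by
    have : b ∈ range φ := hrange ▸ hb.2.1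
    exact this
  have hcof : ∀ x < a, ∃ b ∈ ladderAcc C a, x < b := by
    intro x hx
    obtain ⟨y, hy, -, hxy⟩ := exists_gt_of_isClub ha (hC.club ha) hx
    obtain ⟨i, rfl⟩ : y ∈ range φ := hrange ▸ hy
    exact ⟨φ (nl i), hacc _ (hnl i), hxy.trans (hmono (hnl' i))⟩
  refine ⟨⟨⟨φ (nl l₀), hacc _ (hnl _)⟩, hcof⟩, ?_, ?_, ?_⟩
  · intro B hB hBL
    have hB' : #{i | φ i ∈ B} < lam := by
      rw [mk_ord_toType] at hBL
      refine lt_of_le_of_lt ?_ hBL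
      exact mk_preimage_of_injective φ B hmono.injective
    obtain ⟨i₀, hi₀⟩ := exists_bound hreg _ (Subtype.val : {i | φ i ∈ B} → lam.ord.ToType) hB'
    refine ⟨φ (nl i₀), hacc _ (hnl i₀), fun b hb => ?_⟩
    obtain ⟨i, rfl⟩ := hmem b (hB hb)
    exact (hmono ((hi₀ ⟨i, hb⟩).trans (hnl' i₀))).le
  · intro f h hh
    choose h' hh' using fun i : lam.ord.ToType => show ∃ j, φ i ∈ ladderAcc C a → φ j = h (φ i) by
      by_cases hi : φ i ∈ ladderAcc C a
      · exact (hmem _ (hh _ hi)).imp fun j hj _ => hj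
      · exact ⟨i, fun hi' => absurd hi' hi⟩
    -- Closure under the next-limit function `nl` makes `i` a limit of limits, so the ladder at `φ
    -- i` is cofinal.
    obtain ⟨i, hilim, hi₀, hig, hiF⟩ := index (fun j => f (φ j)) (fun j => max (h' j) (nl j)) l₀
    have hia := hacc i hilim
    have hD : ∀ b, b ∈ ladderAcc C (φ i) ↔ b ∈ ladderAcc C a ∧ b < φ i := fun b => by
      rw [hC.ladderAcc_eq hia]; rfl
    have hnli : ∀ j < i, nl j < i := fun j hj => (le_max_right _ _).trans_lt (hig j hj)
    have hcof_i : ∀ x < φ i, ∃ b ∈ ladderAcc C (φ i), x < b := by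
      intro x hx
      obtain ⟨y, ⟨hy, hyi⟩, hxy⟩ := (lt_isLUB_iff hia.2.2.2).1 hx
      obtain ⟨j, rfl⟩ : y ∈ range φ := hrange ▸ hy
      have hj : j < i := hmono.lt_iff_lt.1 hyi
      exact ⟨φ (nl j), (hD _).2 ⟨hacc _ (hnl j), hmono (hnli j hj)⟩, hxy.trans (hmono (hnl' j))⟩
    refine ⟨φ i, hia, ⟨?_, hcof_i⟩, fun b hb => ?_, fun b hb => ?_⟩
    · exact ⟨φ (nl l₀), (hD _).2 ⟨hacc _ (hnl _), hmono (hnli _ hi₀)⟩⟩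
    · obtain ⟨hba, hbi⟩ := (hD b).1 hb
      obtain ⟨j, rfl⟩ := hmem b hba
      rw [← hh' j hba]
      exact hmono ((le_max_left _ _).trans_lt (hig j (hmono.lt_iff_lt.1 hbi)))
    · obtain ⟨hba, hbi⟩ := (hD b).1 hb
      obtain ⟨j, rfl⟩ := hmem b hba
      have hj : j < i := hmono.lt_iff_lt.1 hbi
      change (if h : ladderIdx C l₀ (φ j) < ladderIdx C l₀ (φ i) then F _ ⟨_, h⟩ else l₀) = _
      rw [hidx i hia, hidx j hba]
      exact (dif_pos hj).trans (hiF ⟨j, hj⟩)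
  · intro b hb q hq
    obtain ⟨j, rfl⟩ := hmem b hb
    rw [mk_ord_toType] at hq
    obtain ⟨l, hl⟩ := hw q.2 hq
    obtain ⟨i, hilim, hi₀, -, hiF⟩ := index (fun _ => p.symm (q.1, l)) id (max l₀ j)
    have hia := hacc i hilim
    refine ⟨φ i, hia, hmono ((le_max_right _ _).trans_lt hi₀), ?_⟩
    have hl₀ : l₀ < i := (le_max_left _ _).trans_lt hi₀
    have key : (if h : l₀ < ladderIdx C l₀ (φ i) then F _ ⟨l₀, h⟩ else l₀) = p.symm (q.1, l) := by
      rw [hidx i hia]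
      exact (dif_pos hl₀).trans (hiF ⟨l₀, hl₀⟩)
    change ((p (if h : l₀ < ladderIdx C l₀ (φ i) then F _ ⟨l₀, h⟩ else l₀)).1,
      w (p (if h : l₀ < ladderIdx C l₀ (φ i) then F _ ⟨l₀, h⟩ else l₀)).2) = q
    rw [key, p.apply_symm_apply, hl]

theorem exists_valid_oracle (hdiamond : DiamondPrinciple lam)
    (hsquare : DiamondSquarePrinciple lam) :
    ∃ O : Oracle (Order.succ lam).ord.ToType lam.ord.ToType, O.Valid := by
  have hreg' : (Order.succ lam).IsRegular := isRegular_succ hreg.1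
  have hunc' : ℵ₀ < Order.succ lam := hunc.trans (Order.lt_succ lam)
  obtain ⟨w, hw⟩ := hdiamond.exists_enum hreg hunc
  have hpow := hdiamond.mk_fun_le hreg hunc
  obtain ⟨F, hF⟩ := hdiamond
  obtain ⟨C, X, hCX, hguess⟩ := hsquare
  have hC : IsLadderSystem lam C := ⟨fun ha => (hCX _ ha).1, fun ha => (hCX _ ha).2.1,
    fun ha => (hCX _ ha).2.2.1, fun ha b hb => ((hCX _ ha).2.2.2.2 b hb).1⟩
  obtain ⟨l₀⟩ := nonempty_ord_toType hreg.pos.ne'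
  have hinf : ℵ₀ ≤ #lam.ord.ToType := by rw [mk_ord_toType]; exact hreg.1
  obtain ⟨p⟩ : Nonempty (lam.ord.ToType ≃ lam.ord.ToType × lam.ord.ToType) := by
    rw [← Cardinal.eq, ← mul_def, mul_eq_self hinf]
  obtain ⟨π⟩ : Nonempty ((Order.succ lam).ord.ToType × (lam.ord.ToType ⊕ lam.ord.ToType) ≃
      (Order.succ lam).ord.ToType) := by
    rw [← Cardinal.eq, ← mul_def, ← add_def, add_eq_self hinf, mk_ord_toType, mk_ord_toType]
    exact mul_eq_left hunc'.le (Order.le_succ lam) hreg.pos.ne'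
  refine ⟨squareOracle C X F l₀ π w p, ?_⟩
  refine {
    lt := hC.lt
    coh := hC.ladderAcc_eq
    idx_inj := hC.ladderIdx_inj
    max_or_cof := fun h => (hC.max_or_cof h).imp_right fun h' => ⟨h, h'⟩
    omega_seq := hC.exists_omega_seq
    short_or_long := fun {a} ha => ?_
    guess := fun Ψ E hE => ?_
    exists_w := fun g hg => hw g (by rwa [mk_ord_toType] at hg)
    aleph0_le := hinf
    pow_le := fun ι hι => hpow ι (by rwa [mk_ord_toType] at hι)
    mk_Iio_le := fun a => by
      rw [mk_ord_toType]
      exact Order.lt_succ_iff.1 (mk_Iio_ord_lt a)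
    bdd := fun ι f hι => exists_bound hreg' ι f (by
      rw [mk_ord_toType] at hι
      exact Order.lt_succ_iff.2 hι) }
  · rcases (hC.type_le ha).eq_or_lt with h | h
    · exact Or.inr (squareOracle_long hreg hunc hC hF hw ha h)
    · refine Or.inl ⟨C a, hC.sub ha, ?_, fun x hx => ?_⟩
      · rw [mk_ord_toType]
        exact Cardinal.lt_ord.1 h
      · obtain ⟨y, hy, -, hxy⟩ := exists_gt_of_isClub ha (hC.club ha) hx
        exact ⟨y, hy, hxy⟩
  -- If `c` is closed under `g`, all codes `π (d, x)` with `d < c` lie below `c` and are therefore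
  -- visible in `X c`.
  · choose g hg using fun b : (Order.succ lam).ord.ToType =>
      exists_bound hreg' (lam.ord.ToType ⊕ lam.ord.ToType)
      (fun x => π (b, x)) (by
        rw [← add_def, add_eq_self hinf, mk_ord_toType]; exact Order.lt_succ lam)
    have hcof : Order.cof (Order.succ lam).ord.ToType ≠ ℵ₀ := by
      rw [Ordinal.cof_toType, hreg'.cof_ord]; exact hunc'.ne'
    obtain ⟨k₀⟩ := nonempty_ord_toType hreg'.pos.ne'
    obtain ⟨a, ha, hty, haE, haX⟩ := hguess {y | (π.symm y).2 ∈ Ψ (π.symm y).1}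
      (E ∩ {i | k₀ ≤ i ∧ ∀ j < i, g j < i}) (hE.inter hcof (isClub_closed_ord hreg' hunc' g k₀))
    refine ⟨a, ha, squareOracle_long hreg hunc hC hF hw ha hty, fun c hc => (haE hc.2).1,
      fun c hc d hd => ?_⟩
    ext x
    change π (d, x) ∈ X c ↔ _
    rw [((hCX a ha).2.2.2.2 c hc.2).2, haX]
    have h₁ : π (d, x) < c := (hg d x).trans ((haE hc.2).2.2 d hd)
    constructor
    · rintro ⟨⟨h, -⟩, -⟩
      simpa using h
    · intro h
      exact ⟨⟨by simpa using h, h₁.trans (hC.lt hc)⟩, h₁⟩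

end Ladders

/-! ### Heights and a criterion for being Souslin. -/

section LevelFunctions

open Set

variable {T : Type u} [PartialOrder T]

/-- `ht` assigns to every element of the tree `T` its level. -/
structure IsLevelFun {K : Type u} [LinearOrder K] (ht : T → K) : Prop where
  lt : ∀ {x y}, x < y → ht x < ht y
  lt_of_lt : ∀ {x y z}, x < z → y < z → ht x < ht y → x < y
  eq_of_eq : ∀ {x y z}, x < z → y < z → ht x = ht y → x = y
  exists_lt : ∀ {z} {a}, a < ht z → ∃ x < z, ht x = a

namespace IsLevelFun

section Height

variable {K : Type u} [LinearOrder K] {ht : T → K} (h : IsLevelFun ht)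
include h

theorem nonempty_relIso (x : T) :
    Nonempty ((fun y z : Iio x => y < z) ≃r (fun a b : Iio (ht x) => a < b)) := by
  let e : Iio x → Iio (ht x) := fun y => ⟨ht y, h.lt y.2⟩
  have he : Function.Bijective e := by
    constructor
    · exact fun y z hyz => Subtype.ext (h.eq_of_eq y.2 z.2 (congrArg Subtype.val hyz))
    · rintro ⟨a, ha⟩
      obtain ⟨y, hy, rfl⟩ := h.exists_lt ha
      exact ⟨⟨y, hy⟩, rfl⟩
  exact ⟨⟨Equiv.ofBijective e he, fun {y z} => ⟨fun hyz => h.lt_of_lt y.2 z.2 hyz, fun hyz =>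
    h.lt (show y.1 < z.1 from hyz)⟩⟩⟩

variable [WellFoundedLT K]

theorem isWellOrder (x : T) : IsWellOrder (Iio x) (· < ·) := by
  obtain ⟨e⟩ := h.nonempty_relIso x
  exact e.toRelEmbedding.isWellOrder

theorem treeHeight_eq (x : T) :
    treeHeight x = Ordinal.typein (α := K) (· < ·) (ht x) := by
  have := h.isWellOrder x
  obtain ⟨e⟩ := h.nonempty_relIso x
  rw [treeHeight, dif_pos this]
  exact e.ordinalType_congr

end Height

variable {κ : Cardinal.{u}} {ht : T → κ.ord.ToType} (h : IsLevelFun ht)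
include h

theorem mem_treeLevel {a : κ.ord.ToType} {x : T} :
    x ∈ treeLevel T (Ordinal.typein (α := κ.ord.ToType) (· < ·) a) ↔ ht x = a := by
  change treeHeight x = _ ↔ _
  rw [h.treeHeight_eq, Ordinal.typein_inj]

omit h in
theorem exists_typein_eq {α : Ordinal.{u}} (hα : α < κ.ord) :
    ∃ a : κ.ord.ToType, Ordinal.typein (α := κ.ord.ToType) (· < ·) a = α := by
  have := Ordinal.mem_range_typein_iff (r := fun x y : κ.ord.ToType => x < y) (o := α)
  rw [Ordinal.type_toType] at this
  exact this.2 hα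

theorem isKappaTree (hne : ∀ a, ∃ x, ht x = a) (hsmall : ∀ a, #{x | ht x = a} < κ) :
    IsKappaTree T κ where
  wellOrdered := h.isWellOrder
  level_nonempty α hα := by
    obtain ⟨a, rfl⟩ := exists_typein_eq hα
    exact (hne a).imp fun x hx => h.mem_treeLevel.2 hx
  level_small α hα := by
    obtain ⟨a, rfl⟩ := exists_typein_eq hα
    have : treeLevel T (Ordinal.typein (α := κ.ord.ToType) (· < ·) a) = {x | ht x = a} :=
      Set.ext fun x => h.mem_treeLevel
    rw [this]
    exact hsmall a
  level_top_empty := by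
    refine eq_empty_of_forall_notMem fun x (hx : treeHeight x = κ.ord) => ?_
    rw [h.treeHeight_eq] at hx
    exact (Ordinal.typein_lt_self (ht x)).ne hx

theorem exists_le {z : T} {a : κ.ord.ToType} (ha : a ≤ ht z) : ∃ x ≤ z, ht x = a := by
  rcases ha.eq_or_lt with rfl | ha
  · exact ⟨z, le_rfl, rfl⟩
  · exact (h.exists_lt ha).imp fun x hx => ⟨hx.1.le, hx.2⟩

theorem exists_branch_mem {α : Ordinal.{u}} {B : Set T}
    (hB : IsTreeBranch α B) {a : κ.ord.ToType}
    (ha : Ordinal.typein (α := κ.ord.ToType) (· < ·) a < α) : ∃ x ∈ B, ht x = a := by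
  have : Ordinal.typein (α := κ.ord.ToType) (· < ·) a ∈ treeHeight '' B := hB.2 ▸ ha
  obtain ⟨x, hx, e⟩ := this
  rw [h.treeHeight_eq, Ordinal.typein_inj] at e
  exact ⟨x, hx, e⟩

theorem eq_of_mem_chain {B : Set T} (hB : IsChain (· ≤ ·) B) {x y : T} (hx : x ∈ B) (hy : y ∈ B)
    (e : ht x = ht y) : x = y := by
  rcases hB.total hx hy with hxy | hxy
  · exact hxy.eq_or_lt.resolve_right fun hlt => (h.lt hlt).ne e
  · exact (hxy.eq_or_lt.resolve_right fun hlt => (h.lt hlt).ne e.symm).symm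

/-- A tree is Souslin if above every node there is a proper splitting, and if for every dense set
some level consists of nodes that are above an element of the set. -/
theorem isSouslinTree {lam : Cardinal.{u}} (hlam : ℵ₀ ≤ lam) (hκ : κ = Order.succ lam)
    (hne : ∀ a, ∃ x, ht x = a) (hsmall : ∀ a, #{x | ht x = a} ≤ lam)
    (hsplit : ∀ x, ∃ y z, x ≤ y ∧ x ≤ z ∧ y ≠ z ∧ ht y = ht z)
    (hhit : ∀ U : Set T, (∀ x, ∃ u ∈ U, x ≤ u) → ∃ a, ∀ z, ht z = a → ∃ u ∈ U, u < z) :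
    IsSouslinTree T κ where
  isKappaTree := h.isKappaTree hne fun a =>
    (Order.lt_succ_iff.2 (hsmall a)).trans_eq hκ.symm
  no_branch := by
    rintro ⟨B, hB⟩
    have mem : ∀ a, ∃ x ∈ B, ht x = a := fun a =>
      h.exists_branch_mem hB (Ordinal.typein_lt_self a)
    -- Splitting makes the complement of `B` dense, but the node of `B` at level `a` has only
    -- members of `B` below it.
    obtain ⟨a, ha⟩ := hhit Bᶜ fun x => by
      obtain ⟨y, z, hy, hz, hne, e⟩ := hsplit x
      by_cases hyB : y ∈ B
      · exact ⟨z, fun hzB => hne (h.eq_of_mem_chain hB.1 hyB hzB e), hz⟩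
      · exact ⟨y, hyB, hy⟩
    obtain ⟨z, hzB, hz⟩ := mem a
    obtain ⟨u, hu, huz⟩ := ha z hz
    obtain ⟨x, hx, e⟩ := mem (ht u)
    have hxz : x < z := by
      rcases hB.1.total hx hzB with hle | hle
      · exact hle.eq_or_lt.resolve_left fun e' => (h.lt huz).ne (e' ▸ e.symm)
      · refine absurd (h.lt huz) (not_lt.2 ?_)
        rw [← e]
        rcases hle.eq_or_lt with rfl | hlt
        · exact le_rfl
        · exact (h.lt hlt).le
    exact hu (h.eq_of_eq hxz huz e ▸ hx)
  no_antichain := by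
    rintro ⟨A, hA, hAκ⟩
    -- The nodes above a member of `A` or incompatible with all of `A` are dense. A member of `A` at
    -- level `a` or higher would lie strictly above one of them, so `A` lives below `a` and has at
    -- most λ elements.
    obtain ⟨a, ha⟩ := hhit {u | (∃ x ∈ A, x ≤ u) ∨ ∀ x ∈ A, ¬ ∃ w, x ≤ w ∧ u ≤ w} fun y => by
      by_cases hy : ∃ x ∈ A, ∃ w, x ≤ w ∧ y ≤ w
      · obtain ⟨x, hx, w, hxw, hyw⟩ := hy
        exact ⟨w, Or.inl ⟨x, hx, hxw⟩, hyw⟩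
      · exact ⟨y, Or.inr fun x hx hw => hy ⟨x, hx, hw⟩, le_rfl⟩
    have hlt : ∀ x ∈ A, ht x < a := by
      intro x hx
      by_contra! hax
      obtain ⟨z, hzx, hz⟩ := h.exists_le hax
      obtain ⟨u, hu, huz⟩ := ha z hz
      rcases hu with ⟨x', hx', hle⟩ | hu
      · have hlt := (hle.trans_lt huz).trans_le hzx
        exact hA hx' hx hlt.ne hlt.le
      · exact hu x hx ⟨x, le_rfl, huz.le.trans hzx⟩
    have h₁ : #A ≤ #(Σ b : Iio a, {x | ht x = b.1}) :=
      ⟨⟨fun x => ⟨⟨ht x, hlt x x.2⟩, ⟨x, rfl⟩⟩, fun x y hxy => Subtype.ext <|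
        congrArg (fun p : Σ b : Iio a, {x | ht x = b.1} => p.2.1) hxy⟩⟩
    have h₂ : #(Σ b : Iio a, {x | ht x = b.1}) ≤ lam := by
      rw [mk_sigma]
      refine (sum_le_sum _ (fun _ => lam) fun b : Iio a => hsmall b.1).trans ?_
      rw [sum_const']
      have h₃ : #(Iio a) ≤ lam := Order.lt_succ_iff.1 ((mk_Iio_ord_lt a).trans_eq hκ)
      exact (mul_le_mul_left h₃ _).trans (mul_eq_self hlam).le
    have h₄ := h₁.trans h₂
    rw [hAκ, hκ] at h₄
    exact h₄.not_gt (Order.lt_succ lam)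

end IsLevelFun

end LevelFunctions

/-! ### The streamlined trees and their properties. -/

section Trees

open Set

namespace BinSeq

variable {κ : Cardinal.{u}}

/-- A binary sequence as a function on `κ`, padded with `false`. -/
noncomputable def seq (t : BinSeq κ) : κ.ord.ToType → Bool := fun x =>
  if h : x < t.len then t.val ⟨x, h⟩ else false

/-- The binary sequence of length `a` given by `s`. -/
def ofFun (a : κ.ord.ToType) (s : κ.ord.ToType → Bool) : BinSeq κ := ⟨a, fun x => s x⟩

@[simp] theorem ofFun_len (a : κ.ord.ToType) (s : κ.ord.ToType → Bool) : (ofFun a s).len = a := rfl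

theorem seq_apply (t : BinSeq κ) {x : κ.ord.ToType} (h : x < t.len) :
    t.seq x = t.val ⟨x, h⟩ := dif_pos h

@[simp] theorem res_seq (t : BinSeq κ) : res t.seq t.len = t.seq := by
  funext x
  by_cases h : x < t.len <;> simp [res, seq, h]

@[simp] theorem seq_ofFun (a : κ.ord.ToType) (s : κ.ord.ToType → Bool) :
    (ofFun a s).seq = res s a := by
  funext x
  by_cases h : x < a
  · rw [res_apply_of_lt h]; exact seq_apply (ofFun a s) h
  · have h' : ¬ x < (ofFun a s).len := h
    exact (dif_neg h').trans (if_neg h).symm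

theorem le_iff {s t : BinSeq κ} : s ≤ t ↔ s.len ≤ t.len ∧ res t.seq s.len = s.seq := by
  rw [← res_seq s, res_eq_iff]
  constructor
  · rintro ⟨h, e⟩
    refine ⟨h, fun x hx => ?_⟩
    rw [seq_apply t (hx.trans_le h), seq_apply s hx, e x hx]
  · rintro ⟨h, e⟩
    refine ⟨h, fun x hx => ?_⟩
    rw [← seq_apply t (hx.trans_le h), ← seq_apply s hx, e x hx]

theorem ext_seq {s t : BinSeq κ} (h : s.len = t.len) (e : s.seq = t.seq) : s = t := by
  refine le_antisymm (le_iff.2 ⟨h.le, ?_⟩) (le_iff.2 ⟨h.ge, ?_⟩)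
  · rw [h, res_seq, e]
  · rw [← h, res_seq, e]

theorem lt_iff {s t : BinSeq κ} : s < t ↔ s.len < t.len ∧ res t.seq s.len = s.seq := by
  constructor
  · intro h
    obtain ⟨h₁, h₂⟩ := le_iff.1 h.le
    refine ⟨h₁.lt_of_ne fun e => h.ne (ext_seq e ?_), h₂⟩
    rw [← h₂, e, res_seq]
  · rintro ⟨h₁, h₂⟩
    refine lt_of_le_of_ne (le_iff.2 ⟨h₁.le, h₂⟩) ?_
    rintro rfl
    exact lt_irrefl _ h₁

end BinSeq

namespace Oracle

variable {lam : Cardinal.{u}} (O : Oracle (Order.succ lam).ord.ToType lam.ord.ToType)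

/-- The tree with index `η`. -/
def tree (η : (Order.succ lam).ord.ToType → Bool) : Set (BinSeq (Order.succ lam)) :=
  {t | t.seq ∈ O.Lev t.len η}

variable {O} {η : (Order.succ lam).ord.ToType → Bool}

theorem ofFun_mem_tree {a : (Order.succ lam).ord.ToType} {s : (Order.succ lam).ord.ToType → Bool}
    (hs : s ∈ O.Lev a η) : BinSeq.ofFun a s ∈ O.tree η := by
  change (BinSeq.ofFun a s).seq ∈ O.Lev a η
  rwa [BinSeq.seq_ofFun, res_of_mem_Lev hs]

/-- The node of the tree given by an element of a level. -/
noncomputable def node (a : (Order.succ lam).ord.ToType) (s : (Order.succ lam).ord.ToType → Bool)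
    (hs : s ∈ O.Lev a η) : O.tree η := ⟨BinSeq.ofFun a s, ofFun_mem_tree hs⟩

@[simp] theorem node_len (a : (Order.succ lam).ord.ToType)
    (s : (Order.succ lam).ord.ToType → Bool) (hs : s ∈ O.Lev a η) : (node a s hs).1.len = a := rfl

@[simp] theorem node_seq (a : (Order.succ lam).ord.ToType)
    (s : (Order.succ lam).ord.ToType → Bool) (hs : s ∈ O.Lev a η) : (node a s hs).1.seq = s :=
  (BinSeq.seq_ofFun a s).trans (res_of_mem_Lev hs)

theorem tree_lt_iff {s t : O.tree η} :
    s < t ↔ s.1.len < t.1.len ∧ res t.1.seq s.1.len = s.1.seq := BinSeq.lt_iff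

theorem mem_tree_of_le {s t : BinSeq (Order.succ lam)} (ht : t ∈ O.tree η) (hst : s ≤ t) :
    s ∈ O.tree η := by
  obtain ⟨h, e⟩ := BinSeq.le_iff.1 hst
  change s.seq ∈ O.Lev s.len η
  rw [← e]
  exact res_mem_Lev ht h

theorem isLevelFun_tree : IsLevelFun fun t : O.tree η => t.1.len where
  lt h := (tree_lt_iff.1 h).1
  lt_of_lt {x y z} hx hy h := by
    refine tree_lt_iff.2 ⟨h, ?_⟩
    rw [← (tree_lt_iff.1 hx).2, ← (tree_lt_iff.1 hy).2, res_res_of_le _ (le_of_lt h)]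
  eq_of_eq {x y z} hx hy (h : x.1.len = y.1.len) := by
    refine Subtype.ext (BinSeq.ext_seq h ?_)
    rw [← (tree_lt_iff.1 hx).2, ← (tree_lt_iff.1 hy).2, h]
  exists_lt {z a} ha := by
    refine ⟨node a (res z.1.seq a) (res_mem_Lev z.2 (le_of_lt ha)), tree_lt_iff.2 ⟨ha, ?_⟩, rfl⟩
    rw [node_seq, node_len]

theorem mk_tree_level_le (hO : O.Valid) (a : (Order.succ lam).ord.ToType) :
    #{t : O.tree η | t.1.len = a} ≤ lam := by
  have h := hO.mk_Lev_le a η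
  rw [mk_ord_toType] at h
  have hmem : ∀ t : {t : O.tree η | t.1.len = a}, t.1.1.seq ∈ O.Lev a η := by
    rintro ⟨t, rfl⟩
    exact t.2
  refine le_trans (mk_le_of_injective (f := fun t => (⟨t.1.1.seq, hmem t⟩ : O.Lev a η)) ?_) h
  rintro ⟨t, ht⟩ ⟨t', ht'⟩ e
  exact Subtype.ext (Subtype.ext (BinSeq.ext_seq (Eq.trans ht (Eq.symm ht'))
    (congrArg Subtype.val e)))

theorem exists_tree_level (hO : O.Valid) (hlam : ℵ₀ ≤ lam) (a : (Order.succ lam).ord.ToType) :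
    ∃ t : O.tree η, t.1.len = a := by
  have := Cardinal.noMaxOrder (hlam.trans (Order.le_succ lam))
  obtain ⟨s, hs⟩ := hO.Lev_nonempty a η
  exact ⟨node a s hs, rfl⟩

theorem isStreamlinedBinaryTree (hO : O.Valid) (hlam : ℵ₀ ≤ lam) :
    IsStreamlinedBinaryTree (Order.succ lam) (O.tree η) where
  downward_closed _ ht _ hst := mem_tree_of_le ht hst
  level_nonempty a := by
    obtain ⟨t, ht⟩ := exists_tree_level (η := η) hO hlam a
    exact ⟨t, t.2, ht⟩
  level_small a := by
    refine Order.lt_succ_iff.2 (le_trans ?_ (mk_tree_level_le (η := η) hO a))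
    exact ⟨⟨fun t => ⟨⟨t.1, t.2.1⟩, t.2.2⟩, fun t t' e => Subtype.ext
      (congrArg (fun x : {t : O.tree η | t.1.len = a} => x.1.1) e)⟩⟩

theorem exists_node_gt (hO : O.Valid) (x : O.tree η) {b : (Order.succ lam).ord.ToType}
    (hb : x.1.len < b) : ∃ y : O.tree η, y.1.len = b ∧ x < y := by
  obtain ⟨y, hy, e⟩ := hO.normalAt b η _ hb _ x.2
  refine ⟨node b y hy, rfl, tree_lt_iff.2 ⟨hb, ?_⟩⟩
  rw [node_seq, e]

theorem isNormalTree (hO : O.Valid) : IsNormalTree (O.tree η) (Order.succ lam) := by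
  intro α β hαβ hβ x hx
  obtain ⟨a, rfl⟩ := IsLevelFun.exists_typein_eq (hαβ.trans hβ)
  obtain ⟨b, rfl⟩ := IsLevelFun.exists_typein_eq hβ
  rw [Ordinal.typein_lt_typein] at hαβ
  have hx' := isLevelFun_tree.mem_treeLevel.1 hx
  obtain ⟨y, hy, hxy⟩ := exists_node_gt hO x (b := b) (hx'.trans_lt hαβ)
  exact ⟨y, isLevelFun_tree.mem_treeLevel.2 hy, hxy⟩

theorem exists_splitting (hO : O.Valid) (x : O.tree η) {b : (Order.succ lam).ord.ToType}
    (hb : x.1.len ⋖ b) :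
    ∃ y z : O.tree η, y ≠ z ∧ y.1.len = b ∧ z.1.len = b ∧ x < y ∧ x < z := by
  have key : ∀ i : Bool, ∃ y : O.tree η, y.1.seq x.1.len = i ∧ y.1.len = b ∧ x < y := by
    intro i
    have h₁ : res (Function.update x.1.seq x.1.len i) x.1.len = x.1.seq := by
      rw [← BinSeq.res_seq x.1, res_eq_iff]
      intro y hy
      rw [Function.update_of_ne hy.ne, BinSeq.res_seq]
    have h₂ : res (Function.update x.1.seq x.1.len i) b ∈ O.Lev b η := by
      refine mem_Lev_of_covBy hO hb (res_res_self _ _) ?_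
      rw [res_res_of_le _ hb.1.le, h₁]
      exact x.2
    refine ⟨node b _ h₂, ?_, rfl, tree_lt_iff.2 ⟨hb.1, ?_⟩⟩
    · rw [node_seq, res_apply_of_lt hb.1, Function.update_self]
    · rw [node_seq, res_res_of_le _ hb.1.le, h₁]
  obtain ⟨y, hy, hyb, hxy⟩ := key true
  obtain ⟨z, hz, hzb, hxz⟩ := key false
  refine ⟨y, z, ?_, hyb, hzb, hxy, hxz⟩
  rintro rfl
  rw [hy] at hz
  cases hz

theorem exists_covBy (hlam : ℵ₀ ≤ lam) (a : (Order.succ lam).ord.ToType) : ∃ b, a ⋖ b := by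
  have := Cardinal.noMaxOrder (hlam.trans (Order.le_succ lam))
  exact ⟨Order.succ a, Order.covBy_succ a⟩

theorem isSplittingTree (hO : O.Valid) (hlam : ℵ₀ ≤ lam) : IsSplittingTree (O.tree η) := by
  intro x
  obtain ⟨b, hb⟩ := exists_covBy hlam x.1.len
  obtain ⟨y, z, hne, hy, hz, hxy, hxz⟩ := exists_splitting hO x hb
  refine ⟨y, z, hne, ⟨hxy, fun w hw hwy => ?_⟩, ⟨hxz, fun w hw hwz => ?_⟩⟩
  · exact hb.2 (isLevelFun_tree.lt hw) (hy ▸ isLevelFun_tree.lt hwy)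
  · exact hb.2 (isLevelFun_tree.lt hw) (hz ▸ isLevelFun_tree.lt hwz)

/-- The guess at `c` prescribes the dropped branch along a cofinal ladder, hence everywhere. -/
theorem Dropped.eq (hO : O.Valid) {c : (Order.succ lam).ord.ToType}
    {s t : (Order.succ lam).ord.ToType → Bool} (hs : O.Dropped c η s) (ht : O.Dropped c η t)
    (hs' : res s c = s) (ht' : res t c = t) : s = t := by
  refine eq_of_res_eq hs' ht' fun x hx => ?_
  obtain ⟨b, hb, hxb⟩ := hs.1.2 x hx
  exact ⟨b, hxb, by rw [hs.2.1 b hb (hO.lt hb), ht.2.1 b hb (hO.lt hb)]⟩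

/-- The union of a branch is a node bounding it unless it was dropped, so a vanishing branch is
exactly the dropped one. -/
theorem exists_dropped {a : (Order.succ lam).ord.ToType} {B : Set (O.tree η)}
    (hB : IsTreeBranch (Ordinal.typein (α := (Order.succ lam).ord.ToType) (· < ·) a) B)
    (hv : IsVanishing B) :
    ∃ s, O.Dropped a η s ∧ res s a = s ∧ ∀ x, x ∈ B ↔ x.1.len < a ∧ res s x.1.len = x.1.seq := by
  have hlen : ∀ x ∈ B, x.1.len < a := by
    intro x hx
    have : treeHeight x ∈ Iio _ := hB.2 ▸ mem_image_of_mem treeHeight hx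
    rwa [mem_Iio, isLevelFun_tree.treeHeight_eq, Ordinal.typein_lt_typein] at this
  obtain ⟨s, hs, hsB⟩ := exists_glue (c := a) (fun x : B => x.1.1.len) (fun x : B => x.1.1.seq)
    (fun x => (hlen x x.2).le) (fun x y hxy => by
      rcases hB.1.total x.2 y.2 with h | h
      · exact (BinSeq.le_iff.1 h).2
      · obtain ⟨h₁, h₂⟩ := BinSeq.le_iff.1 h
        have e := le_antisymm hxy h₁
        rw [e, BinSeq.res_seq, ← h₂, ← e, BinSeq.res_seq])
  have hmem : ∀ b < a, ∃ x ∈ B, x.1.len = b := fun b hb =>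
    isLevelFun_tree.exists_branch_mem hB ((Ordinal.typein_lt_typein _).2 hb)
  refine ⟨s, ?_, hs, fun x => ⟨fun hx => ⟨hlen x hx, hsB ⟨x, hx⟩⟩, ?_⟩⟩
  · by_contra hd
    have hsa : s ∈ O.Lev a η := O.mem_Lev.2 ⟨hs, fun b hb => by
      obtain ⟨x, hx, rfl⟩ := hmem b hb
      rw [hsB ⟨x, hx⟩]
      exact x.2, hd⟩
    refine hv ⟨node a s hsa, fun x hx => le_of_lt (tree_lt_iff.2 ⟨hlen x hx, ?_⟩)⟩
    rw [node_seq, hsB ⟨x, hx⟩]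
  · rintro ⟨hx, e⟩
    obtain ⟨y, hy, hyx⟩ := hmem _ hx
    have : y = x := Subtype.ext (BinSeq.ext_seq hyx (by
      rw [← e, ← hyx]
      exact (hsB ⟨y, hy⟩).symm))
    exact this ▸ hy

theorem isFullTree (hO : O.Valid) : IsFullTree (O.tree η) (Order.succ lam) := by
  intro α hα _ B B' hB hv hB' hv'
  obtain ⟨a, rfl⟩ := IsLevelFun.exists_typein_eq hα
  obtain ⟨s, hs, hs', h⟩ := exists_dropped hB hv
  obtain ⟨t, ht, ht', h'⟩ := exists_dropped hB' hv'
  obtain rfl := hs.eq hO ht hs' ht'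
  ext x
  rw [h, h']

/-- Pairs with distinct coordinates are dense by splitting, so at some level every pair from the two
trees has differed earlier. Were the trees equal, a diagonal pair would violate this. -/
theorem tree_injective (hO : O.Valid) (hlam : ℵ₀ ≤ lam) : Function.Injective O.tree := by
  intro η η' h
  by_contra hne
  have hLev : ∀ a, O.Lev a η = O.Lev a η' := by
    have key : ∀ η η', O.tree η ⊆ O.tree η' → ∀ a, O.Lev a η ⊆ O.Lev a η' := by
      intro η η' h a s hs
      have : (BinSeq.ofFun a s).seq ∈ O.Lev a η' := h (ofFun_mem_tree hs)
      rwa [BinSeq.seq_ofFun, res_of_mem_Lev hs] at this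
    exact fun a => (key _ _ h.subset a).antisymm (key _ _ h.symm.subset a)
  have hJ : #(ULift.{u} Bool) < #lam.ord.ToType := by
    rw [mk_ord_toType]
    exact (lt_aleph0_of_finite _).trans_le hlam
  obtain ⟨a, ha⟩ := hO.exists_hit (J := ULift.{u} Bool) hJ
    (η := fun j => if j.down then η else η') (by
      rintro ⟨_ | _⟩ ⟨_ | _⟩ e
      · rfl
      · exact absurd e.symm hne
      · exact absurd e hne
      · rfl) (fun _ => {f | f ⟨true⟩ ≠ f ⟨false⟩}) (fun b y hy => by
      obtain ⟨d, hd⟩ := exists_covBy hlam b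
      have h₁ : y ⟨true⟩ ∈ O.Lev b η := hy ⟨true⟩
      have h₂ : y ⟨false⟩ ∈ O.Lev b η' := hy ⟨false⟩
      obtain ⟨u, u', hne', hu, hu', hbu, hbu'⟩ := exists_splitting hO (node b _ h₁) hd
      obtain ⟨w, hw, hbw⟩ := exists_node_gt hO (node b _ h₂) hd.1
      have hu₁ : ∀ v : O.tree η, v.1.len = d → v.1.seq ∈ O.Lev d η := fun v hv => hv ▸ v.2
      obtain ⟨v, hv, hbv, hvw⟩ : ∃ v : O.tree η, v.1.len = d ∧ node b _ h₁ < v ∧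
          v.1.seq ≠ w.1.seq := by
        by_cases e : u.1.seq = w.1.seq
        · refine ⟨u', hu', hbu', fun e' => hne' ?_⟩
          exact Subtype.ext (BinSeq.ext_seq (hu.trans hu'.symm) (e.trans e'.symm))
        · exact ⟨u, hu, hbu, e⟩
      refine ⟨d, hd.1.le, fun j => if j.down then v.1.seq else w.1.seq, hvw, ?_⟩
      rintro ⟨_ | _⟩
      · exact ⟨show w.1.seq ∈ O.Lev d η' from hw ▸ w.2,
          (tree_lt_iff.1 hbw).2.trans (node_seq b _ h₂)⟩
      · exact ⟨hu₁ v hv, (tree_lt_iff.1 hbv).2.trans (node_seq b _ h₁)⟩)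
  have := Cardinal.noMaxOrder (hlam.trans (Order.le_succ lam))
  obtain ⟨s, hs⟩ := hO.Lev_nonempty a η
  obtain ⟨d, -, hd⟩ := ha (fun _ => s) (by
    rintro ⟨_ | _⟩
    · exact hLev a ▸ hs
    · exact hs)
  exact hd rfl

end Oracle

end Trees

/-! ### Souslinity of single trees and of products. -/

section Products

open Set

namespace Oracle

variable {lam : Cardinal.{u}} {O : Oracle (Order.succ lam).ord.ToType lam.ord.ToType}

theorem isSouslinTree_tree (hO : O.Valid) (hunc : ℵ₀ < lam)
    (η : (Order.succ lam).ord.ToType → Bool) : IsSouslinTree (O.tree η) (Order.succ lam) := by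
  refine isLevelFun_tree.isSouslinTree hunc.le rfl (exists_tree_level hO hunc.le)
    (mk_tree_level_le hO) (fun x => ?_) fun U hU => ?_
  · obtain ⟨b, hb⟩ := exists_covBy hunc.le x.1.len
    obtain ⟨y, z, hne, hy, hz, hxy, hxz⟩ := exists_splitting hO x hb
    exact ⟨y, z, hxy.le, hxz.le, hne, hy.trans hz.symm⟩
  · have hJ : #PUnit.{u + 1} < #lam.ord.ToType := by
      rw [mk_ord_toType, mk_punit]
      exact one_lt_aleph0.trans hunc
    obtain ⟨a, ha⟩ := hO.exists_hit hJ (η := fun _ => η) (Function.injective_of_subsingleton _)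
      (fun d => {f | ∃ u ∈ U, u.1.len = d ∧ u.1.seq = f ⟨⟩}) fun b y hy => by
        obtain ⟨u, huU, hu⟩ := hU (node b _ (hy ⟨⟩))
        obtain ⟨h₁, h₂⟩ := BinSeq.le_iff.1 hu
        exact ⟨u.1.len, h₁, fun _ => u.1.seq, ⟨u, huU, rfl, rfl⟩, fun _ =>
          ⟨u.2, h₂.trans (node_seq b _ (hy ⟨⟩))⟩⟩
    refine ⟨a, fun z hz => ?_⟩
    obtain ⟨d, hd, u, hu, hud, e⟩ := ha (fun _ => z.1.seq) fun _ => hz ▸ z.2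
    refine ⟨u, hu, tree_lt_iff.2 ⟨?_, ?_⟩⟩
    · exact (hud.trans_lt hd).trans_eq hz.symm
    · rw [hud, e]

variable {J : Type u} {η : J → (Order.succ lam).ord.ToType → Bool}

theorem len_eq (p : TreeProduct (Order.succ lam) fun j => O.tree (η j)) (i j : J) :
    (p.1 i).1.len = (p.1 j).1.len := by
  obtain ⟨α, hα, h⟩ := p.2
  obtain ⟨a, rfl⟩ := IsLevelFun.exists_typein_eq hα
  rw [isLevelFun_tree.mem_treeLevel.1 (h i), isLevelFun_tree.mem_treeLevel.1 (h j)]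

/-- An element of the product, given by its coordinates. -/
def prodMk (b : (Order.succ lam).ord.ToType) (y : ∀ j, O.tree (η j))
    (hy : ∀ j, (y j).1.len = b) : TreeProduct (Order.succ lam) fun j => O.tree (η j) :=
  ⟨y, _, Ordinal.typein_lt_self b, fun j => isLevelFun_tree.mem_treeLevel.2 (hy j)⟩

variable [Nonempty J]

/-- The level of an element of the product. -/
noncomputable def prodLen (p : TreeProduct (Order.succ lam) fun j => O.tree (η j)) :
    (Order.succ lam).ord.ToType := (p.1 (Classical.arbitrary J)).1.len

theorem len_eq_prodLen (p : TreeProduct (Order.succ lam) fun j => O.tree (η j)) (j : J) :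
    (p.1 j).1.len = prodLen p := len_eq p _ _

theorem prodLen_mk {b : (Order.succ lam).ord.ToType} {y : ∀ j, O.tree (η j)}
    (hy : ∀ j, (y j).1.len = b) : prodLen (prodMk b y hy) = b := hy _

theorem isLevelFun_prodLen :
    IsLevelFun (prodLen : (TreeProduct (Order.succ lam) fun j => O.tree (η j)) → _) where
  lt h := isLevelFun_tree.lt ((TreeProduct.lt_iff _ _ _ _).1 h _)
  lt_of_lt {x y z} hx hy h := by
    rw [TreeProduct.lt_iff] at hx hy ⊢
    intro j
    refine isLevelFun_tree.lt_of_lt (hx j) (hy j) ?_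
    rw [len_eq_prodLen, len_eq_prodLen]
    exact h
  eq_of_eq {x y z} hx hy h := by
    rw [TreeProduct.lt_iff] at hx hy
    refine Subtype.ext (funext fun j => isLevelFun_tree.eq_of_eq (hx j) (hy j) ?_)
    rw [len_eq_prodLen, len_eq_prodLen]
    exact h
  exists_lt {z a} ha := by
    have H : ∀ j, ∃ x < z.1 j, x.1.len = a := fun j =>
      isLevelFun_tree.exists_lt (by rw [len_eq_prodLen]; exact ha)
    choose x hx hxa using H
    exact ⟨prodMk a x hxa, (TreeProduct.lt_iff _ _ _ _).2 hx, prodLen_mk hxa⟩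

/-- Vectors of length less than λ behave like nodes: λ^{<λ} = λ bounds the levels, splitting is
coordinatewise, and dense sets are met by `Valid.exists_hit`, where injectivity of `η` keeps the
coordinates independent. -/
theorem isSouslinTree_product (hO : O.Valid) (hunc : ℵ₀ < lam) (hJ : #J < lam)
    (hη : Function.Injective η) :
    IsSouslinTree (TreeProduct (Order.succ lam) fun j => O.tree (η j)) (Order.succ lam) := by
  have hJ' : #J < #lam.ord.ToType := by rwa [mk_ord_toType]
  refine isLevelFun_prodLen.isSouslinTree hunc.le rfl (fun a => ?_) (fun a => ?_) (fun x => ?_)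
    fun U hU => ?_
  · choose y hy using fun j => exists_tree_level (η := η j) hO hunc.le a
    exact ⟨prodMk a y hy, prodLen_mk hy⟩
  · have h := hO.mk_vec_le hJ' a η
    rw [mk_ord_toType] at h
    have hmem : ∀ p : {p : TreeProduct (Order.succ lam) fun j => O.tree (η j) | prodLen p = a},
        ∀ j, (p.1.1 j).1.seq ∈ O.Lev a (η j) := by
      rintro ⟨p, rfl⟩ j
      change (p.1 j).1.seq ∈ O.Lev (prodLen p) (η j)
      rw [← len_eq_prodLen p j]
      exact (p.1 j).2
    refine le_trans (mk_le_of_injective (f := fun p =>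
      (⟨fun j => (p.1.1 j).1.seq, hmem p⟩ : {y : J → _ → Bool | ∀ j, y j ∈ O.Lev a (η j)})) ?_) h
    rintro ⟨p, hp⟩ ⟨q, hq⟩ e
    refine Subtype.ext (Subtype.ext (funext fun j => Subtype.ext (BinSeq.ext_seq ?_ ?_)))
    · rw [len_eq_prodLen, len_eq_prodLen]
      exact Eq.trans hp (Eq.symm hq)
    · exact congrFun (congrArg Subtype.val e) j
  · obtain ⟨b, hb⟩ := exists_covBy hunc.le (prodLen x)
    choose y z hne hy hz hxy hxz using fun j =>
      exists_splitting hO (x.1 j) (b := b) (by rwa [len_eq_prodLen])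
    exact ⟨prodMk b y hy, prodMk b z hz, Or.inr hxy, Or.inr hxz,
      fun e => hne (Classical.arbitrary J) (congrFun (congrArg Subtype.val e) _),
      (prodLen_mk hy).trans (prodLen_mk hz).symm⟩
  · obtain ⟨a, ha⟩ := hO.exists_hit hJ' hη
      (fun d => {f | ∃ u ∈ U, prodLen u = d ∧ ∀ j, (u.1 j).1.seq = f j}) fun b y hy => by
        obtain ⟨u, huU, hu⟩ := hU (prodMk b (fun j => node b _ (hy j)) fun j => rfl)
        have hle : ∀ j, node b _ (hy j) ≤ u.1 j := by
          intro j
          rcases hu with rfl | hu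
          · exact le_rfl
          · exact (hu j).le
        refine ⟨prodLen u, ?_, fun j => (u.1 j).1.seq, ⟨u, huU, rfl, fun j => rfl⟩,
          fun j => ⟨?_, ?_⟩⟩
        · exact (BinSeq.le_iff.1 (hle (Classical.arbitrary J))).1
        · rw [← len_eq_prodLen u j]
          exact (u.1 j).2
        · exact (BinSeq.le_iff.1 (hle j)).2.trans (node_seq b _ (hy j))
    refine ⟨a, fun z hz => ?_⟩
    obtain ⟨d, hd, u, hu, hud, e⟩ := ha (fun j => (z.1 j).1.seq) fun j => by
      rw [← hz, ← len_eq_prodLen z j]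
      exact (z.1 j).2
    refine ⟨u, hu, (TreeProduct.lt_iff _ _ _ _).2 fun j => tree_lt_iff.2 ⟨?_, ?_⟩⟩
    · rw [len_eq_prodLen, len_eq_prodLen, hud, hz]
      exact hd
    · rw [len_eq_prodLen, hud, e]

end Oracle

end Products

theorem theoremC (lam : Cardinal.{u}) (hreg : lam.IsRegular) (hunc : ℵ₀ < lam)
    (hdiamond : DiamondPrinciple lam) (hsquare : DiamondSquarePrinciple lam) :
    ∃ T : ((2 : Cardinal.{u}) ^ Order.succ lam).ord.ToType → Set (BinSeq (Order.succ lam)),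
      Function.Injective T ∧
      (∀ i, IsStreamlinedBinaryTree (Order.succ lam) (T i) ∧
        IsNormalTree (T i) (Order.succ lam) ∧
        IsSplittingTree (T i) ∧
        IsFullTree (T i) (Order.succ lam) ∧
        IsSouslinTree (T i) (Order.succ lam)) ∧
      ∀ (J : Type u) (η : J → ((2 : Cardinal.{u}) ^ Order.succ lam).ord.ToType),
        Nonempty J → #J < lam → Function.Injective η →
          IsSouslinTree (TreeProduct (Order.succ lam) fun j => T (η j)) (Order.succ lam) := by
  obtain ⟨O, hO⟩ := exists_valid_oracle hreg hunc hdiamond hsquare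
  -- The indices below 2^κ are matched with all functions from κ to 2.
  obtain ⟨e⟩ : Nonempty (((2 : Cardinal.{u}) ^ Order.succ lam).ord.ToType ≃
      ((Order.succ lam).ord.ToType → Bool)) := by
    rw [← Cardinal.eq, mk_ord_toType]
    simp
  refine ⟨fun i => O.tree (e i), (Oracle.tree_injective hO hunc.le).comp e.injective, fun i =>
    ⟨Oracle.isStreamlinedBinaryTree hO hunc.le, Oracle.isNormalTree hO,
      Oracle.isSplittingTree hO hunc.le, Oracle.isFullTree hO,
      Oracle.isSouslinTree_tree hO hunc _⟩, fun J η hne hJ hη => ?_⟩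
  exact Oracle.isSouslinTree_product hO hunc hJ (e.injective.comp hη)
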